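/- Let $W(y_1,y_2\mid x)$ be a discrete memoryless broadcast channel with finite input alphabet $\mathcal X$ and finite output alphabets $\mathcal Y_1,\mathcal Y_2$, from Alice to Bob-1 and Bob-2. For $i\in\{1,2\}$ write $\bar i$ for the other index, and $\bar b=b\oplus 1$ for a bit $b$. **Protocols.** In an $(n,k_1,k_2)$ oblivious-transfer protocol Alice holds strings $M_{i0},M_{i1}\in\{0,1\}^{k_i}$ and Bob-$i$ holds a bit $Z_i$, $i\in\{1,2\}$; all strings and bits are uniform, and together with the private randomness $R_A,R_{B_1},R_{B_2}$ of the parties they are mutually independent. The channel is used $n$ times. Before each use and after the last one there is, on each link $i$ (between Alice and Bob-$i$), a finite number of rounds of noiseless communication in which Alice and Bob-$i$ alternately send messages from a finite alphabet; $\mathbf C_i$ denotes the complete transcript of link $i$. A message of Alice on link $i$ is a function of all her strings, $R_A$ and the previous messages of link $i$; a message of Bob-$i$ is a function of $Z_i$, $R_{B_i}$, the outputs $Y_{i,1},\dots,Y_{i,l}$ that he has received so far, and the previous messages of link $i$. The channel input $X_l$ is a function of Alice's strings, $R_A$ and the previous messages of both links. Given $X_l=x$, the pair $(Y_{1,l},Y_{2,l})$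 has law $W(\cdot,\cdot\mid x)$ and is independent of everything generated before. The final views are $U=(M_{10},M_{11},M_{20},M_{21},R_A,X^n,\mathbf C_1,\mathbf C_2)$ for Alice and $V_i=(Z_i,R_{B_i},Y_i^n,\mathbf C_i)$ for Bob-$i$, who forms an estimate $\hat M_{iZ_i}$ of $M_{iZ_i}$ as a function of $V_i$. **Achievability.** A pair $(R_1,R_2)$ is achievable with honest-but-curious colluding parties if there are $(n,k_1,k_2)$ protocols, $n=1,2,\dots$ (with $k_i$ depending on $n$), such that, as $n\to\infty$, $k_i/n\to R_i$ and, for each $i\in\{1,2\}$, $$\Pr[\hat M_{iZ_i}\ne M_{iZ_i}]\to0,\qquad I(M_{1\bar Z_1},M_{2\bar Z_2};V_1,V_2)\to0,\qquad I(Z_i;U,V_{\bar i})\to0,$$ $$I(Z_1,Z_2;U)\to0,\qquad I(M_{i0},M_{i1},M_{\bar i\bar Z_{\bar i}},Z_i;V_{\bar i})\to0 .$$ **Theorem.** If $(R_1,R_2)$ is achievable with honest-but-curious colluding parties, then $R_1,R_2\ge 0$ and $$R_1\le\min\Big\{\max_{P_X}I(X;Y_1),\ \max_{P_X}I(X;Y_1\mid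 Y_2),\ \max_{P_X}H(X\mid Y_1,Y_2)\Big\},$$ $$R_2\le\min\Big\{\max_{P_X}I(X;Y_2),\ \max_{P_X}I(X;Y_2\mid Y_1),\ \max_{P_X}H(X\mid Y_1,Y_2)\Big\},$$ $$R_1+R_2\le\min\Big\{\max_{P_X}I(X;Y_1,Y_2),\ \max_{P_X}H(X\mid Y_1,Y_2)\Big\},$$ where each maximum is over all probability distributions $P_X$ on $\mathcal X$, $(Y_1,Y_2)$ is the channel output for the input $X\sim P_X$, and entropies and mutual informations on the right-hand sides are in bits. -/

import Mathlib

open MeasureTheory ProbabilityTheory Filter Topology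
open scoped ENNReal

noncomputable section

/-! ### Entropies of finite-valued functions under a finite weight function (in bits) -/

/-- `H(f)`: Shannon entropy, in bits, of `f` under the probability weights `q`. -/
def shannonH {S β : Type*} [Fintype S] [Fintype β] (q : S → ℝ) (f : S → β) : ℝ :=
  (∑ b, Real.negMulLog (∑ s, (f ⁻¹' {b}).indicator q s)) / Real.log 2

/-- `H(f | g) = H(f, g) - H(g)`. -/
def shannonCondH {S β γ : Type*} [Fintype S] [Fintype β] [Fintype γ]
    (q : S → ℝ) (f : S → β) (g : S → γ) : ℝ :=
  shannonH q (fun s => (f s, g s)) - shannonH q g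

/-- `I(f ; g) = H(f) - H(f | g)`. -/
def shannonI {S β γ : Type*} [Fintype S] [Fintype β] [Fintype γ]
    (q : S → ℝ) (f : S → β) (g : S → γ) : ℝ :=
  shannonH q f - shannonCondH q f g

/-- `I(f ; g | h) = H(f | h) - H(f | g, h)`. -/
def shannonCondI {S β γ δ : Type*} [Fintype S] [Fintype β] [Fintype γ] [Fintype δ]
    (q : S → ℝ) (f : S → β) (g : S → γ) (h : S → δ) : ℝ :=
  shannonCondH q f h - shannonCondH q f (fun s => (g s, h s))

/-! ### Single-letter quantities of a broadcast channel

The two receivers are indexed by `i : Fin 2`, the other receiver is `i.rev`, and the channel is a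
family `W x` of probability mass functions on the pairs `y = (y 0, y 1)` of outputs. -/

section Channel

variable {𝒳 : Type*} {𝒴 : Fin 2 → Type*} [Fintype 𝒳] [∀ i, Fintype (𝒴 i)]

/-- The joint law of `(X, (Y₁, Y₂))` when `X` has law `p`. -/
def channelJoint (W : 𝒳 → PMF (∀ i, 𝒴 i)) (p : 𝒳 → ℝ) : 𝒳 × (∀ i, 𝒴 i) → ℝ :=
  fun s => p s.1 * (W s.1 s.2).toReal

/-- The maximum of `F` over all probability distributions on `𝒳`. -/
def maxOverInputs (F : (𝒳 → ℝ) → ℝ) : ℝ := sSup (F '' stdSimplex ℝ 𝒳)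

/-- `max_{P_X} I(X ; Y_i)` -/
def maxI (W : 𝒳 → PMF (∀ i, 𝒴 i)) (i : Fin 2) : ℝ :=
  maxOverInputs fun p => shannonI (channelJoint W p) (fun s => s.1) (fun s => s.2 i)

/-- `max_{P_X} I(X ; Y_i | Y_j)`, where `j` is the other receiver. -/
def maxCondI (W : 𝒳 → PMF (∀ i, 𝒴 i)) (i : Fin 2) : ℝ :=
  maxOverInputs fun p =>
    shannonCondI (channelJoint W p) (fun s => s.1) (fun s => s.2 i) (fun s => s.2 i.rev)

/-- `max_{P_X} I(X ; Y₁, Y₂)` -/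
def maxJointI (W : 𝒳 → PMF (∀ i, 𝒴 i)) : ℝ :=
  maxOverInputs fun p => shannonI (channelJoint W p) (fun s => s.1) (fun s => s.2)

/-- `max_{P_X} H(X | Y₁, Y₂)` -/
def maxEquivocation (W : 𝒳 → PMF (∀ i, 𝒴 i)) : ℝ :=
  maxOverInputs fun p => shannonCondH (channelJoint W p) (fun s => s.1) (fun s => s.2)

theorem continuous_shannonH_channelJoint {β : Type*} [Fintype β] (W : 𝒳 → PMF (∀ i, 𝒴 i))
    (f : 𝒳 × (∀ i, 𝒴 i) → β) : Continuous fun p => shannonH (channelJoint W p) f := by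
  classical
  unfold shannonH channelJoint
  refine Continuous.div_const (continuous_finsetSum _ fun b _ =>
    Real.continuous_negMulLog.comp (continuous_finsetSum _ fun s _ => ?_)) _
  by_cases h : s ∈ f ⁻¹' {b}
  · simp only [Set.indicator_of_mem h]
    fun_prop
  · simp only [Set.indicator_of_notMem h]
    fun_prop

/-- A continuous functional attains `maxOverInputs`, so that this is indeed a maximum. -/
theorem isGreatest_maxOverInputs [Nonempty 𝒳] {F : (𝒳 → ℝ) → ℝ} (hF : Continuous F) :
    IsGreatest (F '' stdSimplex ℝ 𝒳) (maxOverInputs F) := by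
  classical
  obtain ⟨x⟩ := ‹Nonempty 𝒳›
  exact ((isCompact_stdSimplex ℝ 𝒳).image hF).isGreatest_sSup
    ⟨_, _, single_mem_stdSimplex ℝ x, rfl⟩

end Channel

/-! ### Protocols -/

/-- Transcripts are discrete. -/
instance instMeasurableSpaceListFin (a : ℕ) : MeasurableSpace (List (Fin a)) := ⊤

/-- The strings of Alice: `m i b` is the string `m_{ib}` of length `k i`. -/
abbrev OTStrings (k : Fin 2 → ℕ) : Type := ∀ i : Fin 2, Bool → Fin (k i) → Bool

/-- `r` rounds of alternating messages that continue the transcript `h`: in each round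
first `a` speaks and then `b`, each as a function of the transcript so far. -/
def exchange {α : Type*} (a b : List α → α) : ℕ → List α → List α
  | 0, h => h
  | r + 1, h =>
    let h₀ := exchange a b r h
    let h₁ := h₀ ++ [a h₀]
    h₁ ++ [b h₁]

/-- The strategies of Alice and the two Bobs in a protocol with `n` accesses to the broadcast
channel and strings of lengths `k 0`, `k 1`. Session `l` of public communication takes place after
`l` channel accesses, `l = 0, …, n`. On link `i`, between Alice and Bob-`i`, it consists of
`rounds i l` rounds. A message of Alice on link `i` is a function of her strings, her private
randomness and the transcript of link `i`; a message of Bob-`i` is a function of his choice bit,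
his private randomness, his channel outputs so far and the transcript of link `i`. A channel input
is a function of the strings, Alice's private randomness and the transcripts of both links.
The length of a transcript determines the session and the round of the next message. -/
structure OTProtocol (𝒳 : Type*) (𝒴 : Fin 2 → Type*) [MeasurableSpace 𝒳]
    (n : ℕ) (k : Fin 2 → ℕ) where
  /-- size of the alphabet of public messages -/
  msgCard : ℕ
  /-- values of Alice's private randomness -/
  RandA : Type
  /-- values of the private randomness of Bob-`i` -/
  RandB : Fin 2 → Type
  [measurableSpaceA : MeasurableSpace RandA]
  [measurableSpaceB : ∀ i, MeasurableSpace (RandB i)]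
  rounds : Fin 2 → ℕ → ℕ
  aliceMsg : Fin 2 → OTStrings k → RandA → List (Fin msgCard) → Fin msgCard
  bobMsg : ∀ i, Bool → RandB i → List (𝒴 i) → List (Fin msgCard) → Fin msgCard
  input : Fin n → OTStrings k → RandA → (Fin 2 → List (Fin msgCard)) → 𝒳
  decode : ∀ i, Bool → RandB i → (Fin n → 𝒴 i) → List (Fin msgCard) → (Fin (k i) → Bool)
  measurable_aliceMsg : ∀ i m h, Measurable fun r => aliceMsg i m r h
  measurable_bobMsg : ∀ i z y h, Measurable fun r => bobMsg i z r y h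
  measurable_input : ∀ l m h, Measurable fun r => input l m r h
  measurable_decode : ∀ i z y h, Measurable fun r => decode i z r y h

attribute [instance] OTProtocol.measurableSpaceA OTProtocol.measurableSpaceB

namespace OTProtocol

variable {𝒳 : Type*} {𝒴 : Fin 2 → Type*} [MeasurableSpace 𝒳] {n : ℕ} {k : Fin 2 → ℕ}

/-- The transcript of link `i` at the end of session `l`, when Bob-`i`'s channel outputs are `y`
(only the first `l` of them are used). -/
def transcript (π : OTProtocol 𝒳 𝒴 n k) (i : Fin 2) (m : OTStrings k) (z : Bool)
    (rA : π.RandA) (rB : π.RandB i) (y : Fin n → 𝒴 i) : ℕ → List (Fin π.msgCard)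
  | 0 => exchange (π.aliceMsg i m rA) (π.bobMsg i z rB []) (π.rounds i 0) []
  | l + 1 => exchange (π.aliceMsg i m rA) (π.bobMsg i z rB ((List.ofFn y).take (l + 1)))
      (π.rounds i (l + 1)) (π.transcript i m z rA rB y l)

/-- The `l`-th channel input; it depends only on the outputs `y t` with `t < l`. -/
def channelInput (π : OTProtocol 𝒳 𝒴 n k) (m : OTStrings k) (z : Fin 2 → Bool)
    (rA : π.RandA) (rB : ∀ i, π.RandB i) (y : Fin n → ∀ i, 𝒴 i) (l : Fin n) : 𝒳 :=
  π.input l m rA fun i => π.transcript i m (z i) rA (rB i) (fun t => y t i) l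

/-- The random variables that arise when the parties follow the protocol `π` over the memoryless
broadcast channel `W`. -/
structure Run (π : OTProtocol 𝒳 𝒴 n k) [∀ i, MeasurableSpace (𝒴 i)]
    (W : 𝒳 → PMF (∀ i, 𝒴 i)) where
  Ω : Type
  [measurableSpace : MeasurableSpace Ω]
  P : Measure Ω
  [isProbabilityMeasure : IsProbabilityMeasure P]
  /-- Alice's strings -/
  M : Ω → OTStrings k
  /-- the choice bits of the two Bobs -/
  Z : Ω → Fin 2 → Bool
  RA : Ω → π.RandA
  RB : Ω → ∀ i, π.RandB i
  /-- the channel outputs -/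
  Y : Fin n → Ω → ∀ i, 𝒴 i
  measurable_M : Measurable M
  measurable_Z : Measurable Z
  measurable_RA : Measurable RA
  measurable_RB : Measurable RB
  measurable_Y : ∀ l, Measurable (Y l)
  /-- `M` and `Z` are uniform, and `M, Z, R_A, R_{B₁}, R_{B₂}` are mutually independent. -/
  law_inputs : P.map (fun ω => (M ω, Z ω, RA ω, RB ω)) =
    (uniformOn Set.univ).prod ((uniformOn Set.univ).prod
      ((P.map RA).prod (Measure.pi fun i => P.map fun ω => RB ω i)))
  /-- Given that the `l`-th channel input is `x`, the `l`-th pair of channel outputs has law `W x`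
  and is independent of everything that was generated before. -/
  law_channel : ∀ (l : Fin n) (x : 𝒳) (y : ∀ i, 𝒴 i)
    (E : Set (OTStrings k × (Fin 2 → Bool) × π.RandA × (∀ i, π.RandB i) ×
      (Set.Iio l → ∀ i, 𝒴 i))), MeasurableSet E →
    P {ω | (M ω, Z ω, RA ω, RB ω, fun t : Set.Iio l => Y t ω) ∈ E ∧
        π.channelInput (M ω) (Z ω) (RA ω) (RB ω) (fun t => Y t ω) l = x ∧ Y l ω = y} =
      P {ω | (M ω, Z ω, RA ω, RB ω, fun t : Set.Iio l => Y t ω) ∈ E ∧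
        π.channelInput (M ω) (Z ω) (RA ω) (RB ω) (fun t => Y t ω) l = x} * W x y

attribute [instance] Run.measurableSpace Run.isProbabilityMeasure

namespace Run

variable [∀ i, MeasurableSpace (𝒴 i)] {W : 𝒳 → PMF (∀ i, 𝒴 i)} {π : OTProtocol 𝒳 𝒴 n k}

/-- The channel inputs `X^n`. -/
def X (e : π.Run W) (ω : e.Ω) : Fin n → 𝒳 :=
  π.channelInput (e.M ω) (e.Z ω) (e.RA ω) (e.RB ω) fun t => e.Y t ω

/-- The full public transcript of link `i`. -/
def C (e : π.Run W) (i : Fin 2) (ω : e.Ω) : List (Fin π.msgCard) :=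
  π.transcript i (e.M ω) (e.Z ω i) (e.RA ω) (e.RB ω i) (fun t => e.Y t ω i) n

/-- The string `M_{i Z_i}` chosen by Bob-`i`. -/
def chosen (e : π.Run W) (i : Fin 2) (ω : e.Ω) : Fin (k i) → Bool := e.M ω i (e.Z ω i)

/-- The string not chosen by Bob-`i`. -/
def unchosen (e : π.Run W) (i : Fin 2) (ω : e.Ω) : Fin (k i) → Bool := e.M ω i (!e.Z ω i)

/-- Bob-`i`'s estimate of the string chosen by him. -/
def estimate (e : π.Run W) (i : Fin 2) (ω : e.Ω) : Fin (k i) → Bool :=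
  π.decode i (e.Z ω i) (e.RB ω i) (fun t => e.Y t ω i) (e.C i ω)

/-- Alice's final view: all strings, `R_A`, `X^n` and both transcripts. -/
def U (e : π.Run W) (ω : e.Ω) :
    OTStrings k × π.RandA × (Fin n → 𝒳) × (Fin 2 → List (Fin π.msgCard)) :=
  (e.M ω, e.RA ω, e.X ω, fun i => e.C i ω)

/-- Bob-`i`'s final view: `Z_i`, `R_{B_i}`, `Y_i^n` and the transcript of link `i`. -/
def V (e : π.Run W) (i : Fin 2) (ω : e.Ω) :
    Bool × π.RandB i × (Fin n → 𝒴 i) × List (Fin π.msgCard) :=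
  (e.Z ω i, e.RB ω i, fun t => e.Y t ω i, e.C i ω)

end Run

end OTProtocol

/-- The mutual information `I(A ; B)` of two random variables with values in arbitrary measurable
spaces: the Kullback-Leibler divergence of their joint law from the product of their laws. -/
def mutualInfo {Ω α β : Type*} [MeasurableSpace Ω] [MeasurableSpace α] [MeasurableSpace β]
    (P : Measure Ω) (A : Ω → α) (B : Ω → β) : ℝ≥0∞ :=
  InformationTheory.klDiv (P.map fun ω => (A ω, B ω)) ((P.map A).prod (P.map B))

/-- `R` is an achievable oblivious-transfer rate pair over the broadcast channel `W` for
honest-but-curious colluding parties. -/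
def AchievableColluding {𝒳 : Type*} {𝒴 : Fin 2 → Type*} [MeasurableSpace 𝒳]
    [∀ i, MeasurableSpace (𝒴 i)] (W : 𝒳 → PMF (∀ i, 𝒴 i)) (R : Fin 2 → ℝ) : Prop :=
  ∃ (k : ℕ → Fin 2 → ℕ) (π : ∀ n, OTProtocol 𝒳 𝒴 n (k n)) (e : ∀ n, (π n).Run W),
    (∀ i, Tendsto (fun n => (k n i : ℝ) / n) atTop (𝓝 (R i))) ∧
    (∀ i, Tendsto (fun n => (e n).P {ω | (e n).estimate i ω ≠ (e n).chosen i ω}) atTop (𝓝 0)) ∧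
    Tendsto (fun n => mutualInfo (e n).P
      (fun ω => ((e n).unchosen 0 ω, (e n).unchosen 1 ω))
      (fun ω => ((e n).V 0 ω, (e n).V 1 ω))) atTop (𝓝 0) ∧
    (∀ i, Tendsto (fun n => mutualInfo (e n).P
      (fun ω => (e n).Z ω i)
      (fun ω => ((e n).U ω, (e n).V i.rev ω))) atTop (𝓝 0)) ∧
    Tendsto (fun n => mutualInfo (e n).P (e n).Z (e n).U) atTop (𝓝 0) ∧
    (∀ i, Tendsto (fun n => mutualInfo (e n).P
      (fun ω => ((e n).M ω i, (e n).unchosen i.rev ω, (e n).Z ω i))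
      ((e n).V i.rev)) atTop (𝓝 0))

end

/-! The converse treats oblivious transfer as a source of secret keys.

Obliviousness turns the secrecy of the unchosen string into secrecy of the chosen one. The unchosen
string of Bob-i is hidden from both Bobs together, hence from an observer who knows `Z_i`, both
transcripts and the other Bob's view. Since `Z_i` is uniform and nearly independent of Alice's view
joined with the other Bob's view, negating it hardly changes the joint law, and the negation
exchanges the chosen with the unchosen string (`condEnt_le_condEnt_perm`,
`IsRunLaw.condEnt_swap_le`). So the chosen string also has equivocation about `k_i` for that
observer (`IsRunLaw.condEnt_chosen_ge`). By Fano's inequality Bob-i knows it, so it is a key shared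
with Alice, and its length is at most their conditional mutual information given the observer's data
(`condEnt_le_condEnt_add_condMI`).

That mutual information is 0 at the start, does not grow in public discussion
(`condMI_exchange_le`), and grows in a channel use by at most a single-letter quantity. For an
observer of link i alone the growth is at most I(X;Y_i); if he also holds the other Bob's view and
transcript, it is at most I(X;Y_i|Y_j). Treating the two Bobs as one receiver and negating both bits
at once gives I(X;Y_1,Y_2) for the sum of the lengths.

For the equivocation bound, Alice's data and the Bobs' data are conditionally independent given the
inputs and the transcripts (`IsRunLaw.condMI_inputs_le_zero`). Hence inputs, transcripts and `Z_i`
nearly determine the chosen string, and after the exchange also the unchosen one. The unchosen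
strings, with k_1+k_2 bits of equivocation for the Bobs, thus have almost no more of it than X^n
given the outputs, which is at most n max H(X|Y_1,Y_2). The individual equivocation bounds follow
because rates are nonnegative.

All estimates are made on a finite probability space. Bounded transcripts make the private
randomness matter only through a finite table of responses, and vanishing Kullback-Leibler
divergence is used only through total variation. The continuity estimates involve the alphabet of
the strings but not that of the views, so vanishing security errors cost o(n) bits. -/

/-! ### Entropy calculus for finite weights

Entropies are in nats. The target types are arbitrary, since only the partition of the finite space
into fibres matters. -/

namespace FiniteEntropy

variable {S T α β γ δ : Type*}

/-- `f` determines `g`. -/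
def Det (f : S → α) (g : S → β) : Prop := ∀ s t, f s = f t → g s = g t

theorem Det.trans {f : S → α} {g : S → β} {h : S → γ} (h₁ : Det f g) (h₂ : Det g h) : Det f h :=
  fun s t e => h₂ s t (h₁ s t e)

theorem Det.pair {f : S → α} {g : S → β} {h : S → γ} (h₁ : Det f g) (h₂ : Det f h) :
    Det f fun s => (g s, h s) :=
  fun s t e => Prod.ext (h₁ s t e) (h₂ s t e)

theorem Det.comp {f : S → α} (F : α → β) : Det f fun s => F (f s) := fun _ _ e => congrArg F e

variable [Fintype S] [Fintype T]

/-- The total weight of the fibre of `f` over `b`. -/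
noncomputable def mass (q : S → ℝ) (f : S → β) (b : β) : ℝ := ∑ s, (f ⁻¹' {b}).indicator q s

/-- The entropy of `f` under the weights `q`, in nats. -/
noncomputable def ent (q : S → ℝ) (f : S → β) : ℝ := -∑ s, q s * Real.log (mass q f (f s))

/-- The conditional entropy of `f` given `g`, in nats. -/
noncomputable def condEnt (q : S → ℝ) (f : S → α) (g : S → β) : ℝ :=
  ent q (fun s => (f s, g s)) - ent q g

/-- The conditional mutual information of `f` and `g` given `h`, in nats. -/
noncomputable def condMI (q : S → ℝ) (f : S → α) (g : S → β) (h : S → γ) : ℝ :=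
  condEnt q f h - condEnt q f (fun s => (g s, h s))

theorem mass_eq_sum_filter (q : S → ℝ) (f : S → β) (b : β) [DecidablePred fun s => f s = b] :
    mass q f b = ∑ s with f s = b, q s := by
  classical
  rw [mass, Finset.sum_filter]
  refine Finset.sum_congr rfl fun s _ => ?_
  by_cases h : f s = b <;> simp [h]

theorem mass_nonneg {q : S → ℝ} (hq : ∀ s, 0 ≤ q s) (f : S → β) (b : β) : 0 ≤ mass q f b :=
  Finset.sum_nonneg fun _ _ => Set.indicator_nonneg (fun _ _ => hq _) _

theorem le_mass {q : S → ℝ} (hq : ∀ s, 0 ≤ q s) (f : S → β) (s : S) : q s ≤ mass q f (f s) := by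
  classical
  rw [mass_eq_sum_filter]
  exact Finset.single_le_sum (f := q) (fun t _ => hq t) (by simp)

theorem mass_pos {q : S → ℝ} (hq : ∀ s, 0 ≤ q s) (f : S → β) {s : S} (hs : 0 < q s) :
    0 < mass q f (f s) := hs.trans_le (le_mass hq f s)

theorem mass_le_of_det {q : S → ℝ} (hq : ∀ s, 0 ≤ q s) {f : S → α} {g : S → β} (h : Det g f)
    (s : S) : mass q g (g s) ≤ mass q f (f s) := by
  classical
  rw [mass_eq_sum_filter, mass_eq_sum_filter]
  refine Finset.sum_le_sum_of_subset_of_nonneg ?_ fun t _ _ => hq t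
  intro t ht
  simp only [Finset.mem_filter, Finset.mem_univ, true_and] at ht ⊢
  exact h _ _ ht

theorem sum_mul_comp [DecidableEq β] (q : S → ℝ) (f : S → β) (φ : β → ℝ) :
    ∑ s, q s * φ (f s) = ∑ b ∈ Finset.univ.image f, mass q f b * φ b := by
  classical
  rw [← Finset.sum_fiberwise_of_maps_to (s := Finset.univ) (t := Finset.univ.image f) (g := f)
    (fun s _ => Finset.mem_image_of_mem f (Finset.mem_univ s))]
  refine Finset.sum_congr rfl fun b _ => ?_
  rw [mass_eq_sum_filter, Finset.sum_mul]
  refine Finset.sum_congr rfl fun s hs => ?_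
  rw [(Finset.mem_filter.1 hs).2]

theorem sum_mass_image [DecidableEq β] (q : S → ℝ) (f : S → β) :
    ∑ b ∈ Finset.univ.image f, mass q f b = ∑ s, q s := by
  simpa using (sum_mul_comp q f fun _ => 1).symm

theorem sum_mass [Fintype β] (q : S → ℝ) (f : S → β) : ∑ b, mass q f b = ∑ s, q s := by
  classical
  simp only [mass_eq_sum_filter]
  exact Finset.sum_fiberwise _ _ _

theorem sum_mass_pair [DecidableEq α] (q : S → ℝ) (f : S → α) (g : S → β) (b : β) :
    ∑ a ∈ Finset.univ.image f, mass q (fun s => (f s, g s)) (a, b) = mass q g b := by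
  classical
  simp only [mass_eq_sum_filter, Prod.mk.injEq]
  rw [← Finset.sum_fiberwise_of_maps_to (s := Finset.univ.filter fun s => g s = b)
    (t := Finset.univ.image f) (g := f)
    (fun s _ => Finset.mem_image_of_mem f (Finset.mem_univ s))]
  refine Finset.sum_congr rfl fun a _ => ?_
  rw [Finset.filter_filter]
  refine Finset.sum_congr (Finset.filter_congr fun s _ => and_comm) fun _ _ => rfl

theorem mass_comp (q : S → ℝ) (φ : S → T) (f : T → β) (b : β) :
    mass (mass q φ) f b = mass q (fun s => f (φ s)) b := by
  classical
  simp only [mass_eq_sum_filter]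
  rw [← Finset.sum_fiberwise_of_maps_to (s := Finset.univ.filter fun s => f (φ s) = b)
    (t := Finset.univ.filter fun t => f t = b) (g := φ) (fun s hs => by simpa using hs)]
  refine Finset.sum_congr rfl fun t ht => ?_
  rw [Finset.filter_filter]
  refine Finset.sum_congr (Finset.filter_congr fun s _ => ?_) fun _ _ => rfl
  have := (Finset.mem_filter.1 ht).2
  grind

theorem mass_const_perm (c : ℝ) (f : S → β) (τ : Equiv.Perm S) (σ : Equiv.Perm β)
    (h : ∀ s, f (τ s) = σ (f s)) (b : β) : mass (fun _ => c) f (σ b) = mass (fun _ => c) f b := by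
  rw [mass, ← Equiv.sum_comp τ]
  refine Finset.sum_congr rfl fun s _ => ?_
  by_cases e : f s = b <;> simp [Set.indicator, h, e]

theorem ent_congr (q : S → ℝ) {f : S → α} {g : S → β} (h : Det f g) (h' : Det g f) :
    ent q f = ent q g := by
  classical
  unfold ent
  congr 1
  refine Finset.sum_congr rfl fun s _ => ?_
  rw [mass_eq_sum_filter, mass_eq_sum_filter]
  congr 3
  ext t
  simp only [Finset.mem_filter, Finset.mem_univ, true_and]
  exact ⟨h t s, h' t s⟩

theorem ent_mono {q : S → ℝ} (hq : ∀ s, 0 ≤ q s) {f : S → α} {g : S → β} (h : Det g f) :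
    ent q f ≤ ent q g := by
  unfold ent
  refine neg_le_neg (Finset.sum_le_sum fun s _ => ?_)
  rcases (hq s).eq_or_lt with hs | hs
  · simp [← hs]
  · exact mul_le_mul_of_nonneg_left
      (Real.log_le_log (mass_pos hq g hs) (mass_le_of_det hq h s)) (hq s)

theorem condEnt_nonneg {q : S → ℝ} (hq : ∀ s, 0 ≤ q s) (f : S → α) (g : S → β) :
    0 ≤ condEnt q f g :=
  sub_nonneg.2 (ent_mono hq (Det.comp (f := fun s => (f s, g s)) Prod.snd))

/-- Gibbs' inequality for conditional distributions. -/
theorem condEnt_le_cross [DecidableEq α] {q : S → ℝ} (hq : ∀ s, 0 ≤ q s) (f : S → α) (g : S → β)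
    (w : α → β → ℝ) (hw : ∀ a b, 0 ≤ w a b) (hw₁ : ∀ b, ∑ a ∈ Finset.univ.image f, w a b ≤ 1)
    (hpos : ∀ s, 0 < q s → 0 < w (f s) (g s)) :
    condEnt q f g ≤ -∑ s, q s * Real.log (w (f s) (g s)) := by
  classical
  set m : S → ℝ := fun s => mass q (fun s => (f s, g s)) (f s, g s) with hm
  -- This is log x ≤ x - 1 for the ratio x of the competing to the true conditional probability,
  -- weighted by `q s`. The right-hand sides sum to at most 0 because `w` is subnormalised.
  have hpoint : ∀ s, q s * Real.log (mass q g (g s)) - q s * Real.log (m s)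
      + q s * Real.log (w (f s) (g s)) ≤
      q s * (w (f s) (g s) * mass q g (g s) / m s) - q s := by
    intro s
    rcases (hq s).eq_or_lt with hs | hs
    · simp [← hs]
    · have h₁ : 0 < mass q g (g s) := mass_pos hq g hs
      have h₂ : 0 < m s := mass_pos hq (fun s => (f s, g s)) hs
      have h₃ := hpos s hs
      have h₄ := Real.log_le_sub_one_of_pos (x := w (f s) (g s) * mass q g (g s) / m s)
        (by positivity)
      rw [Real.log_div (by positivity) h₂.ne', Real.log_mul h₃.ne' h₁.ne'] at h₄
      nlinarith
  have hsum : ∑ s, q s * (w (f s) (g s) * mass q g (g s) / m s) ≤ ∑ s, q s := by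
    have h₁ := sum_mul_comp q (fun s => (f s, g s)) fun p =>
      w p.1 p.2 * mass q g p.2 / mass q (fun s => (f s, g s)) p
    rw [hm]
    refine h₁.le.trans ?_
    calc _ ≤ ∑ p ∈ Finset.univ.image fun s => (f s, g s), w p.1 p.2 * mass q g p.2 := by
          refine Finset.sum_le_sum fun p _ => ?_
          by_cases h : mass q (fun s => (f s, g s)) p = 0
          · simpa [h] using mul_nonneg (hw p.1 p.2) (mass_nonneg hq g p.2)
          · rw [mul_div_cancel₀ _ h]
      _ ≤ ∑ p ∈ Finset.univ.image f ×ˢ Finset.univ.image g, w p.1 p.2 * mass q g p.2 := by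
          refine Finset.sum_le_sum_of_subset_of_nonneg ?_ fun p _ _ =>
            mul_nonneg (hw p.1 p.2) (mass_nonneg hq g p.2)
          intro p hp
          simp only [Finset.mem_image, Finset.mem_univ, true_and, Finset.mem_product] at hp ⊢
          obtain ⟨s, rfl⟩ := hp
          exact ⟨⟨s, rfl⟩, ⟨s, rfl⟩⟩
      _ = ∑ b ∈ Finset.univ.image g, (∑ a ∈ Finset.univ.image f, w a b) * mass q g b := by
          rw [Finset.sum_product_right]
          simp only [Finset.sum_mul]
      _ ≤ ∑ b ∈ Finset.univ.image g, mass q g b :=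
          Finset.sum_le_sum fun b _ => mul_le_of_le_one_left (mass_nonneg hq g b) (hw₁ b)
      _ = ∑ s, q s := sum_mass_image q g
  have htot := Finset.sum_le_sum fun s (_ : s ∈ Finset.univ) => hpoint s
  simp only [Finset.sum_add_distrib, Finset.sum_sub_distrib] at htot
  unfold condEnt ent
  linarith

/-- The conditional distribution of `f` given `g`. -/
noncomputable def condDist (q : S → ℝ) (f : S → α) (g : S → β) (a : α) (b : β) : ℝ :=
  mass q (fun s => (f s, g s)) (a, b) / mass q g b

theorem condDist_nonneg {q : S → ℝ} (hq : ∀ s, 0 ≤ q s) (f : S → α) (g : S → β) (a : α) (b : β) :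
    0 ≤ condDist q f g a b :=
  div_nonneg (mass_nonneg hq _ _) (mass_nonneg hq _ _)

theorem condDist_pos {q : S → ℝ} (hq : ∀ s, 0 ≤ q s) (f : S → α) (g : S → β) {s : S}
    (hs : 0 < q s) : 0 < condDist q f g (f s) (g s) :=
  div_pos (mass_pos hq (fun s => (f s, g s)) hs) (mass_pos hq g hs)

theorem sum_condDist_le_one [DecidableEq α] (q : S → ℝ) (f : S → α) (g : S → β) (b : β) :
    ∑ a ∈ Finset.univ.image f, condDist q f g a b ≤ 1 := by
  unfold condDist
  rw [← Finset.sum_div, sum_mass_pair]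
  exact div_self_le_one _

theorem condEnt_eq_neg_sum_log {q : S → ℝ} (hq : ∀ s, 0 ≤ q s) (f : S → α) (g : S → β) :
    condEnt q f g = -∑ s, q s * Real.log (condDist q f g (f s) (g s)) := by
  have : ∀ s, q s * Real.log (condDist q f g (f s) (g s)) =
      q s * Real.log (mass q (fun s => (f s, g s)) (f s, g s))
        - q s * Real.log (mass q g (g s)) := by
    intro s
    rcases (hq s).eq_or_lt with hs | hs
    · simp [← hs]
    · rw [condDist, Real.log_div (mass_pos hq (fun s => (f s, g s)) hs).ne' (mass_pos hq g hs).ne',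
        mul_sub]
  simp only [this, Finset.sum_sub_distrib]
  unfold condEnt ent
  linarith

/-- Gibbs' inequality, with the conditional law of `f` given `h` alone as the competitor. -/
theorem condEnt_pair_le {q : S → ℝ} (hq : ∀ s, 0 ≤ q s) (f : S → α) (g : S → β) (h : S → γ) :
    condEnt q f (fun s => (g s, h s)) ≤ condEnt q f h := by
  classical
  rw [condEnt_eq_neg_sum_log hq f h]
  exact condEnt_le_cross hq f (fun s => (g s, h s)) (fun a p => condDist q f h a p.2)
    (fun a p => condDist_nonneg hq f h a p.2) (fun p => sum_condDist_le_one q f h p.2)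
    fun s hs => condDist_pos hq f h hs

/-- Submodularity of entropy. -/
theorem ent_submod {q : S → ℝ} (hq : ∀ s, 0 ≤ q s) {f : S → α} {g : S → β} {j : S → γ}
    {m : S → δ} (hf : Det f m) (hg : Det g m) (hj : Det (fun s => (f s, g s)) j) :
    ent q j + ent q m ≤ ent q f + ent q g := by
  have h := condEnt_pair_le hq f g m
  have h₁ : ent q (fun s => (f s, m s)) = ent q f :=
    ent_congr q (Det.comp Prod.fst) (Det.pair (fun _ _ e => e) hf)
  have h₂ : ent q (fun s => (g s, m s)) = ent q g :=
    ent_congr q (Det.comp Prod.fst) (Det.pair (fun _ _ e => e) hg)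
  have h₃ : ent q j ≤ ent q (fun s => (f s, g s, m s)) :=
    ent_mono hq fun s t e => hj s t (by simp_all)
  unfold condEnt at h
  linarith

/-- A conditional entropy decreases when the conditioning is refined. -/
theorem condEnt_anti {q : S → ℝ} (hq : ∀ s, 0 ≤ q s) (f : S → α) {g : S → β} {h : S → γ}
    (hgh : Det g h) : condEnt q f g ≤ condEnt q f h := by
  have := ent_submod hq (f := fun s => (f s, h s)) (g := g) (j := fun s => (f s, g s)) (m := h)
    (Det.comp Prod.snd) hgh (fun s t e => by simp_all)
  unfold condEnt
  linarith

theorem condEnt_mono {q : S → ℝ} (hq : ∀ s, 0 ≤ q s) {f : S → α} {f' : S → δ} (g : S → β)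
    (h : Det (fun s => (f' s, g s)) f) : condEnt q f g ≤ condEnt q f' g :=
  sub_le_sub_right (ent_mono hq (Det.pair h (Det.comp Prod.snd))) _

theorem condEnt_congr_right (q : S → ℝ) (f : S → α) {g : S → β} {h : S → γ}
    (hgh : Det g h) (hhg : Det h g) : condEnt q f g = condEnt q f h := by
  unfold condEnt
  rw [ent_congr q hgh hhg, ent_congr q (f := fun s => (f s, g s)) (g := fun s => (f s, h s))]
  · exact Det.pair (Det.comp Prod.fst) ((Det.comp Prod.snd).trans hgh)
  · exact Det.pair (Det.comp Prod.fst) ((Det.comp Prod.snd).trans hhg)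

theorem condEnt_le_card [Fintype α] {q : S → ℝ} (hq : ∀ s, 0 ≤ q s)
    (f : S → α) (g : S → β) : condEnt q f g ≤ (∑ s, q s) * Real.log (Fintype.card α) := by
  classical
  rcases isEmpty_or_nonempty α with hα | hα
  · have : IsEmpty S := Function.isEmpty f
    simp [condEnt, ent]
  refine (condEnt_le_cross hq f g (fun _ _ => (Fintype.card α : ℝ)⁻¹) (fun _ _ => by positivity)
    (fun b => ?_) (fun _ _ => by positivity)).trans_eq ?_
  · rw [Finset.sum_const, nsmul_eq_mul, ← div_eq_mul_inv]
    exact div_le_one_of_le₀ (by exact_mod_cast Finset.card_le_univ _) (by positivity)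
  · rw [Finset.sum_mul, ← Finset.sum_neg_distrib]
    simp [Real.log_inv]

theorem ent_const {q : S → ℝ} (hq : ∑ s, q s = 1) (c : β) : ent q (fun _ => c) = 0 := by
  simp [ent, mass, hq]

theorem ent_le_card [Fintype α] {q : S → ℝ} (hq : ∀ s, 0 ≤ q s) (hq₁ : ∑ s, q s = 1)
    (f : S → α) : ent q f ≤ Real.log (Fintype.card α) := by
  have h := condEnt_le_card hq f fun _ => ()
  have h' : ent q (fun s => (f s, ())) = ent q f :=
    ent_congr q (Det.comp Prod.fst) (Det.comp fun a => (a, ()))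
  rw [condEnt, ent_const hq₁, h', hq₁] at h
  linarith

theorem ent_of_mass_eq {q : S → ℝ} (hq₁ : ∑ s, q s = 1) (f : S → α) (c : ℝ)
    (h : ∀ a, mass q f a = c) : ent q f = -Real.log c := by
  simp [ent, h, ← Finset.sum_mul, hq₁]

theorem sum_comp_eq_sum_mass_mul [Fintype β] (q : S → ℝ) (f : S → β) (φ : β → ℝ) :
    ∑ s, q s * φ (f s) = ∑ b, mass q f b * φ b := by
  classical
  rw [sum_mul_comp]
  refine Finset.sum_subset (Finset.subset_univ _) fun b _ hb => ?_
  rw [mass_eq_sum_filter, Finset.sum_eq_zero, zero_mul]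
  intro s hs
  exact absurd (Finset.mem_image.2 ⟨s, Finset.mem_univ s, (Finset.mem_filter.1 hs).2⟩) hb

/-- `mass q φ` is the law of `φ`. Passing to it allows two laws on one common space to be compared.
-/
theorem ent_mass (q : S → ℝ) (φ : S → T) (f : T → β) :
    ent (mass q φ) f = ent q fun s => f (φ s) := by
  unfold ent
  rw [← sum_comp_eq_sum_mass_mul q φ fun t => Real.log (mass (mass q φ) f (f t))]
  simp only [mass_comp]

theorem condEnt_mass (q : S → ℝ) (φ : S → T) (f : T → α) (g : T → β) :
    condEnt (mass q φ) f g = condEnt q (fun s => f (φ s)) fun s => g (φ s) := by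
  unfold condEnt
  rw [ent_mass q φ g, ent_mass q φ fun t => (f t, g t)]

theorem shannonH_eq_ent [Fintype β] (q : S → ℝ) (f : S → β) :
    shannonH q f = ent q f / Real.log 2 := by
  unfold shannonH ent
  rw [sum_comp_eq_sum_mass_mul q f fun b => Real.log (mass q f b), ← Finset.sum_neg_distrib]
  simp [Real.negMulLog, mass]

end FiniteEntropy

/-! ### Fano's inequality and continuity of conditional entropy -/

namespace FiniteEntropy

variable {S T α β γ δ : Type*} [Fintype S] [Fintype T]

/-- Concavity for unnormalised weights: the conditional law of the mixture competes in Gibbs'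
inequality for each of the two parts. -/
theorem condEnt_superadditive {r r' : S → ℝ} (hr : ∀ s, 0 ≤ r s) (hr' : ∀ s, 0 ≤ r' s)
    (f : S → α) (g : S → β) :
    condEnt r f g + condEnt r' f g ≤ condEnt (fun s => r s + r' s) f g := by
  classical
  have hq : ∀ s, 0 ≤ r s + r' s := fun s => add_nonneg (hr s) (hr' s)
  have h₁ := condEnt_le_cross hr f g (condDist (fun s => r s + r' s) f g)
    (condDist_nonneg hq f g) (sum_condDist_le_one _ f g)
    fun s hs => condDist_pos hq f g (by linarith [hr' s])
  have h₂ := condEnt_le_cross hr' f g (condDist (fun s => r s + r' s) f g)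
    (condDist_nonneg hq f g) (sum_condDist_le_one _ f g)
    fun s hs => condDist_pos hq f g (by linarith [hr s])
  rw [condEnt_eq_neg_sum_log hq]
  simp only [add_mul, Finset.sum_add_distrib]
  linarith

/-- The competitor for the mixture is the average of the two conditional laws. It is at least half
of either, which costs at most log 2 per unit of mass. -/
theorem condEnt_add_le {r r' : S → ℝ} (hr : ∀ s, 0 ≤ r s) (hr' : ∀ s, 0 ≤ r' s)
    (f : S → α) (g : S → β) :
    condEnt (fun s => r s + r' s) f g ≤
      condEnt r f g + condEnt r' f g + (∑ s, (r s + r' s)) * Real.log 2 := by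
  classical
  have hq : ∀ s, 0 ≤ r s + r' s := fun s => add_nonneg (hr s) (hr' s)
  set w : α → β → ℝ := fun a b => condDist r f g a b / 2 + condDist r' f g a b / 2 with hw
  have hk := condDist_nonneg hr f g
  have hk' := condDist_nonneg hr' f g
  have key : ∀ (u v : ℝ) (c : ℝ), 0 ≤ c → 0 ≤ v → (0 < c → 0 < u) →
      c * Real.log u - c * Real.log 2 ≤ c * Real.log (u / 2 + v / 2) := by
    intro u v c hc hv hu
    rcases hc.eq_or_lt with h | h
    · simp [← h]
    · rw [← mul_sub, ← Real.log_div (hu h).ne' two_ne_zero]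
      have := hu h
      exact mul_le_mul_of_nonneg_left (Real.log_le_log (by positivity) (by linarith)) hc
  refine (condEnt_le_cross hq f g w (fun a b => ?_) (fun b => ?_) fun s hs => ?_).trans ?_
  · have := hk a b; have := hk' a b; positivity
  · simp only [hw, Finset.sum_add_distrib, ← Finset.sum_div]
    linarith [sum_condDist_le_one r f g b, sum_condDist_le_one r' f g b]
  · rcases (hr s).eq_or_lt with h | h
    · have := condDist_pos hr' f g (s := s) (by linarith)
      have := hk (f s) (g s)
      positivity
    · have := condDist_pos hr f g h
      have := hk' (f s) (g s)
      positivity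
  · have h₁ := Finset.sum_le_sum fun s (_ : s ∈ Finset.univ) =>
      key (condDist r f g (f s) (g s)) (condDist r' f g (f s) (g s)) (r s) (hr s) (hk' _ _)
        fun hs => condDist_pos hr f g hs
    have h₂ := Finset.sum_le_sum fun s (_ : s ∈ Finset.univ) =>
      key (condDist r' f g (f s) (g s)) (condDist r f g (f s) (g s)) (r' s) (hr' s) (hk _ _)
        fun hs => condDist_pos hr' f g hs
    rw [condEnt_eq_neg_sum_log hr, condEnt_eq_neg_sum_log hr']
    simp only [Finset.sum_sub_distrib, ← Finset.sum_mul] at h₁ h₂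
    have h₃ : ∑ s, (r s + r' s) * Real.log (w (f s) (g s)) =
        ∑ s, r s * Real.log (condDist r f g (f s) (g s) / 2 + condDist r' f g (f s) (g s) / 2) +
        ∑ s, r' s *
          Real.log (condDist r' f g (f s) (g s) / 2 + condDist r f g (f s) (g s) / 2) := by
      rw [← Finset.sum_add_distrib]
      refine Finset.sum_congr rfl fun s _ => ?_
      rw [hw, add_comm (condDist r' f g (f s) (g s) / 2)]
      ring
    rw [h₃, Finset.sum_add_distrib, add_mul]
    linarith

/-- Conditional entropy is continuous in total variation, uniformly in the conditioning. -/
theorem condEnt_le_of_dist_le [Fintype α] [Nonempty α] {p p' : S → ℝ} (hp : ∀ s, 0 ≤ p s)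
    (hp' : ∀ s, 0 ≤ p' s) (hp₁ : ∑ s, p' s = 1) {ε : ℝ} (h : ∑ s, |p' s - p s| ≤ ε) (f : S → α)
    (g : S → β) :
    condEnt p' f g ≤ condEnt p f g + ε * Real.log (Fintype.card α) + Real.log 2 := by
  -- Both laws contain the common part min(p, p'). Dropping the excess of `p` only lowers the
  -- entropy; the excess of `p'` has mass at most `ε` and contributes at most `ε` times the
  -- log-cardinality of the target of `f`.
  have hr : ∀ s, 0 ≤ min (p s) (p' s) := fun s => le_min (hp s) (hp' s)
  have h₁ : ∀ s, 0 ≤ p s - min (p s) (p' s) := fun s => sub_nonneg.2 (min_le_left _ _)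
  have h₂ : ∀ s, 0 ≤ p' s - min (p s) (p' s) := fun s => sub_nonneg.2 (min_le_right _ _)
  have a₁ := condEnt_superadditive hr h₁ f g
  have a₂ := condEnt_add_le hr h₂ f g
  simp only [add_sub_cancel] at a₁ a₂
  have a₃ := condEnt_nonneg h₁ f g
  have a₄ := condEnt_le_card h₂ f g
  have a₅ : ∑ s, (p' s - min (p s) (p' s)) ≤ ε := by
    refine (Finset.sum_le_sum fun s _ => ?_).trans h
    rcases min_cases (p s) (p' s) with ⟨e, _⟩ | ⟨e, _⟩ <;> rw [e]
    · exact le_abs_self _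
    · simp
  have a₆ : (0 : ℝ) ≤ Real.log (Fintype.card α) :=
    Real.log_nonneg (by exact_mod_cast Fintype.card_pos)
  have a₇ := mul_le_mul_of_nonneg_right a₅ a₆
  rw [hp₁, one_mul] at a₂
  linarith

/-- Fano's inequality. -/
theorem condEnt_le_of_error_le [Fintype α] {q : S → ℝ} (hq : ∀ s, 0 ≤ q s) (hq₁ : ∑ s, q s = 1)
    (f : S → α) (g : S → β) (f' : S → α) (hf' : Det g f') {ε : ℝ}
    (hε : ∑ s, {s | f' s ≠ f s}.indicator q s ≤ ε) :
    condEnt q f g ≤ Real.log 2 + ε * Real.log (Fintype.card α) := by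
  classical
  rcases isEmpty_or_nonempty α with hα | hα
  · have : IsEmpty S := Function.isEmpty f
    simp at hq₁
  have hc : (0 : ℝ) < Fintype.card α := by exact_mod_cast Fintype.card_pos
  have hl : (0 : ℝ) ≤ Real.log (Fintype.card α) :=
    Real.log_nonneg (by exact_mod_cast Fintype.card_pos)
  -- Gibbs' inequality against the kernel that gives 1/2 to the estimate and spreads the other 1/2
  -- evenly over the alphabet. A correct estimate costs log 2, a wrong one log 2 plus the
  -- log-cardinality.
  refine (condEnt_anti hq f hf').trans ((condEnt_le_cross hq f f'
    (fun a b => if b = a then 1 / 2 else 1 / (2 * Fintype.card α)) (fun a b => ?_) (fun b => ?_)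
    fun s _ => ?_).trans ?_)
  · split_ifs <;> positivity
  · calc _ ≤ ∑ a : α, ((if b = a then 1 / 2 else 0) + 1 / (2 * (Fintype.card α : ℝ))) := by
          refine (Finset.sum_le_sum_of_subset_of_nonneg (Finset.subset_univ _)
            fun a _ _ => by split_ifs <;> positivity).trans (Finset.sum_le_sum fun a _ => ?_)
          split_ifs
          · have : 0 ≤ 1 / (2 * (Fintype.card α : ℝ)) := by positivity
            linarith
          · simp
      _ = 1 := by
          rw [Finset.sum_add_distrib]
          simp
          field_simp
          norm_num
  · split_ifs <;> positivity
  · have : ∀ s, q s * Real.log (if f' s = f s then 1 / 2 else 1 / (2 * (Fintype.card α : ℝ))) =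
        -(q s * Real.log 2) - {s | f' s ≠ f s}.indicator q s * Real.log (Fintype.card α) := by
      intro s
      by_cases h : f' s = f s
      · simp [h]
      · simp only [h, if_false, one_div, Real.log_inv, Set.indicator, Set.mem_ofPred_eq, ne_eq,
          not_false_eq_true, if_true]
        rw [Real.log_mul two_ne_zero hc.ne']
        ring
    simp only [this, Finset.sum_sub_distrib, Finset.sum_neg_distrib, ← Finset.sum_mul, hq₁]
    nlinarith

/-! ### Weakly dependent functions -/

/-- The `ℓ¹` distance of the joint law of `f` and `g` from the product of their laws. -/
noncomputable def dependence [Fintype α] [Fintype β] (q : S → ℝ) (f : S → α) (g : S → β) : ℝ :=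
  ∑ a, ∑ b, |mass q (fun s => (f s, g s)) (a, b) - mass q f a * mass q g b|

theorem condEnt_fst_snd_mul [Fintype α] [Fintype β] {a : α → ℝ} {b : β → ℝ} (ha : ∀ x, 0 ≤ a x)
    (ha₁ : ∑ x, a x = 1) (hb : ∀ y, 0 ≤ b y) (hb₁ : ∑ y, b y = 1) :
    condEnt (fun p : α × β => a p.1 * b p.2) Prod.fst Prod.snd = ent a id := by
  classical
  rw [condEnt_eq_neg_sum_log fun p => mul_nonneg (ha _) (hb _)]
  have h₁ : ∀ y, mass (fun p : α × β => a p.1 * b p.2) Prod.snd y = b y := by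
    intro y
    rw [mass, Fintype.sum_prod_type]
    simp [Set.indicator, Finset.sum_ite_eq', ← Finset.sum_mul, ha₁]
  have h₂ : ∀ p, mass (fun p : α × β => a p.1 * b p.2) (fun p => (p.1, p.2)) p
      = a p.1 * b p.2 := by
    intro p
    rw [mass]
    simp [Set.indicator]
  have h₃ : ∀ x, mass a id x = a x := by
    intro x
    simp [mass, Set.indicator]
  unfold ent condDist
  congr 1
  simp only [h₁, h₂, h₃, Fintype.sum_prod_type, id]
  refine Finset.sum_congr rfl fun x _ => ?_
  calc _ = ∑ y, b y * (a x * Real.log (a x)) := by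
        refine Finset.sum_congr rfl fun y _ => ?_
        rcases (hb y).eq_or_lt with h | h
        · simp [← h]
        · rw [mul_div_cancel_right₀ _ h.ne']
          ring
    _ = a x * Real.log (a x) := by rw [← Finset.sum_mul, hb₁, one_mul]

/-- If `f` and `g` are nearly independent, then the equivocation of `f` given `g` is nearly the
entropy of `f`. -/
theorem ent_le_condEnt_of_dependence_le [Fintype α] [Nonempty α] [Fintype β] {q : S → ℝ}
    (hq : ∀ s, 0 ≤ q s) (hq₁ : ∑ s, q s = 1) (f : S → α) (g : S → β) {ε : ℝ}
    (h : dependence q f g ≤ ε) :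
    ent q f ≤ condEnt q f g + ε * Real.log (Fintype.card α) + Real.log 2 := by
  have hf₁ : ∑ a, mass q f a = 1 := by rw [sum_mass, hq₁]
  have hg₁ : ∑ b, mass q g b = 1 := by rw [sum_mass, hq₁]
  have h₁ := condEnt_le_of_dist_le (p := mass q fun s => (f s, g s))
    (p' := fun p : α × β => mass q f p.1 * mass q g p.2) (mass_nonneg hq _)
    (fun p => mul_nonneg (mass_nonneg hq _ _) (mass_nonneg hq _ _)) (ε := ε)
    (by rw [Fintype.sum_prod_type]; simp [← Finset.mul_sum, hf₁, hg₁])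
    (by rw [Fintype.sum_prod_type]; simpa only [abs_sub_comm, dependence] using h)
    Prod.fst Prod.snd
  rw [condEnt_fst_snd_mul (mass_nonneg hq f) hf₁ (mass_nonneg hq g) hg₁, ent_mass, condEnt_mass]
    at h₁
  exact h₁

/-- If the law of `z` is invariant under `σ` and `z` is nearly independent of `j`, then `z` may be
replaced by `σ z` in the equivocation of a function of `z` and `j` given `z` and a function
of `j`. -/
theorem condEnt_le_condEnt_perm [Fintype α] [Nonempty α] [Fintype β] [Fintype γ] {q : S → ℝ}
    (hq : ∀ s, 0 ≤ q s) (hq₁ : ∑ s, q s = 1) (z : S → β) (j : S → γ) (σ : Equiv.Perm β)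
    (hσ : ∀ b, mass q z (σ.symm b) = mass q z b) {ε : ℝ} (h : dependence q z j ≤ ε)
    (f : β → γ → α) (g : γ → δ) :
    condEnt q (fun s => f (z s) (j s)) (fun s => (g (j s), z s)) ≤
      condEnt q (fun s => f (σ (z s)) (j s)) (fun s => (g (j s), z s))
        + 2 * ε * Real.log (Fintype.card α) + Real.log 2 := by
  have hm : ∀ b c, mass q (fun s => (σ (z s), j s)) (b, c) =
      mass q (fun s => (z s, j s)) (σ.symm b, c) := by
    classical
    intro b c
    simp only [mass_eq_sum_filter, Prod.mk.injEq, ← Equiv.eq_symm_apply]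
  have hd : ∑ p, |mass q (fun s => (z s, j s)) p - mass q (fun s => (σ (z s), j s)) p|
      ≤ 2 * ε := by
    -- The law of `z` is invariant under `σ`, so the law of (σ z, j) is as close to the product law
    -- as that of (z, j). The triangle inequality through the product law gives `2 * ε`.
    have h' : ∑ b, ∑ c, |mass q (fun s => (z s, j s)) (σ.symm b, c) -
        mass q z (σ.symm b) * mass q j c| ≤ ε := by
      refine le_trans (le_of_eq ?_) h
      exact Equiv.sum_comp σ.symm fun b => ∑ c, |mass q (fun s => (z s, j s)) (b, c) -
        mass q z b * mass q j c|
    have h'' := add_le_add h h'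
    rw [dependence, ← Finset.sum_add_distrib] at h''
    simp only [← Finset.sum_add_distrib] at h''
    rw [Fintype.sum_prod_type, two_mul]
    refine le_trans (Finset.sum_le_sum fun b _ => Finset.sum_le_sum fun c _ => ?_) h''
    rw [hm, hσ b]
    set x := mass q (fun s => (z s, j s)) (b, c)
    set y := mass q (fun s => (z s, j s)) (σ.symm b, c)
    rw [abs_sub_comm y]
    exact abs_sub_le _ _ _
  have h₁ := condEnt_le_of_dist_le (mass_nonneg hq fun s => (σ (z s), j s))
    (mass_nonneg hq fun s => (z s, j s)) (by rw [sum_mass, hq₁]) hd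
    (fun p => f p.1 p.2) fun p => (g p.2, p.1)
  rw [condEnt_mass, condEnt_mass] at h₁
  refine h₁.trans_eq ?_
  congr 2
  -- Since `σ` is a bijection, conditioning on σ z is the same as conditioning on `z`.
  apply condEnt_congr_right
  · exact fun s t e => by simpa using e
  · exact fun s t e => by simpa using e

end FiniteEntropy

/-! ### Interactive communication and channel uses -/

namespace FiniteEntropy

variable {S α β γ δ ε α' β' γ' ε' : Type*} [Fintype S]

theorem condMI_eq (q : S → ℝ) (f : S → α) (g : S → β) (h : S → γ) :
    condMI q f g h = ent q (fun s => (f s, h s)) - ent q h - ent q (fun s => (f s, g s, h s))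
      + ent q (fun s => (g s, h s)) := by
  unfold condMI condEnt
  ring

theorem condMI_congr (q : S → ℝ) (f : S → α) {g : S → β} {h : S → γ} {g' : S → β'} {h' : S → γ'}
    (h₁ : Det h h') (h₂ : Det h' h) (h₃ : Det (fun s => (g s, h s)) g')
    (h₄ : Det (fun s => (g' s, h' s)) g) : condMI q f g h = condMI q f g' h' := by
  unfold condMI
  rw [condEnt_congr_right q f h₁ h₂, condEnt_congr_right q f (g := fun s => (g s, h s))
    (h := fun s => (g' s, h' s))]
  · exact h₃.pair ((Det.comp Prod.snd).trans h₁)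
  · exact h₄.pair ((Det.comp Prod.snd).trans h₂)

/-- A message computed from the left side and the public information does not increase the
conditional mutual information. -/
theorem condMI_le_of_det_left {q : S → ℝ} (hq : ∀ s, 0 ≤ q s) (f : S → α) (g : S → β) {h : S → γ}
    {h' : S → γ'} (hh : Det h' h) (hf : Det (fun s => (f s, h s)) h') :
    condMI q f g h' ≤ condMI q f g h := by
  -- In the form H(g|h) - H(g|f,h), refining `h` to `h'` can only lower the first term and leaves
  -- the second unchanged, because `h'` is a function of (f, h).
  have h₁ := condEnt_anti hq g hh
  have e₁ : ent q (fun s => (f s, h' s)) = ent q (fun s => (f s, h s)) :=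
    ent_congr q ((Det.comp Prod.fst).pair ((Det.comp Prod.snd).trans hh))
      ((Det.comp Prod.fst).pair hf)
  have e₂ : ent q (fun s => (f s, g s, h' s)) = ent q (fun s => (f s, g s, h s)) := by
    refine ent_congr q (fun s t e => ?_) (fun s t e => ?_) <;>
      have a₁ := hh s t <;> have a₂ := hf s t <;> simp_all
  rw [condMI_eq, condMI_eq]
  unfold condEnt at h₁
  linarith

/-- A message computed from the right side and the public information does not increase the
conditional mutual information. -/
theorem condMI_le_of_det_right {q : S → ℝ} (hq : ∀ s, 0 ≤ q s) (f : S → α) (g : S → β) {h : S → γ}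
    {h' : S → γ'} (hh : Det h' h) (hg : Det (fun s => (g s, h s)) h') :
    condMI q f g h' ≤ condMI q f g h := by
  have h₁ := condEnt_anti hq f hh
  have e₁ : ent q (fun s => (g s, h' s)) = ent q (fun s => (g s, h s)) :=
    ent_congr q ((Det.comp Prod.fst).pair ((Det.comp Prod.snd).trans hh))
      ((Det.comp Prod.fst).pair hg)
  have e₂ : ent q (fun s => (f s, g s, h' s)) = ent q (fun s => (f s, g s, h s)) := by
    refine ent_congr q (fun s t e => ?_) (fun s t e => ?_) <;>
      have a₁ := hh s t <;> have a₂ := hg s t <;> simp_all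
  rw [condMI_eq, condMI_eq]
  unfold condEnt at h₁
  linarith

/-- Public discussion does not increase the conditional mutual information. -/
theorem condMI_exchange_le {q : S → ℝ} (hq : ∀ s, 0 ≤ q s) (f : S → α) (g : S → β) (d : S → δ)
    (a b : S → List ε → ε) (h : S → List ε) (ha : Det f a) (hb : Det (fun s => (g s, d s)) b)
    (r : ℕ) :
    condMI q f g (fun s => (exchange (a s) (b s) r (h s), d s)) ≤
      condMI q f g (fun s => (h s, d s)) := by
  induction r with
  | zero => exact le_rfl
  | succ r ih =>
    refine le_trans ?_ ih
    set h₀ : S → List ε := fun s => exchange (a s) (b s) r (h s)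
    set h₁ : S → List ε := fun s => h₀ s ++ [a s (h₀ s)]
    change condMI q f g (fun s => (h₁ s ++ [b s (h₁ s)], d s)) ≤ condMI q f g fun s => (h₀ s, d s)
    refine (condMI_le_of_det_right hq f g (h := fun s => (h₁ s, d s)) ?_ ?_).trans
      (condMI_le_of_det_left hq f g ?_ ?_)
    · intro s t e
      simp only [Prod.mk.injEq] at e ⊢
      exact ⟨(List.append_inj' e.1 rfl).1, e.2⟩
    · intro s t e
      simp only [Prod.mk.injEq] at e ⊢
      rw [e.2.1, hb s t (Prod.ext e.1 e.2.2)]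
      exact ⟨rfl, e.2.2⟩
    · intro s t e
      simp only [Prod.mk.injEq, h₁] at e ⊢
      exact ⟨(List.append_inj' e.1 rfl).1, e.2⟩
    · intro s t e
      simp only [Prod.mk.injEq, h₁] at e ⊢
      rw [e.2.1, ha s t e.1]
      exact ⟨rfl, e.2.2⟩

/-- If the noise is independent of the past, then so is the noise of a component of the output. -/
theorem condEnt_past_of_det {q : S → ℝ} (hq : ∀ s, 0 ≤ q s) {x : S → α} {p : S → β} {y : S → γ}
    {y' : S → γ'} (hpx : Det p x) (hy : Det y y') (h : condEnt q y p = condEnt q y x) :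
    condEnt q y' p = condEnt q y' x := by
  refine le_antisymm (condEnt_anti hq y' hpx) ?_
  -- Submodularity says H(y|y',p) ≤ H(y|y',x). Subtracting this from the equality H(y|p) = H(y|x)
  -- leaves H(y'|p) ≥ H(y'|x).
  have h₁ := ent_submod hq (f := fun s => (y s, x s)) (g := fun s => (y' s, p s))
    (j := fun s => (y s, p s)) (m := fun s => (y' s, x s))
    (((Det.comp Prod.fst).trans hy).pair (Det.comp Prod.snd))
    ((Det.comp Prod.fst).pair ((Det.comp Prod.snd).trans hpx)) (fun s t e => by simp_all)
  unfold condEnt at h ⊢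
  linarith

/-- A channel use increases the mutual information of the input side and the output side by at most
the information that the channel conveys. -/
theorem condMI_channel_le {q : S → ℝ} (hq : ∀ s, 0 ≤ q s) {f : S → α} {g : S → β} {h : S → γ}
    {x : S → δ} {y : S → ε} {p : S → ε'} (hf : Det p f) (hg : Det p g) (hh : Det p h)
    (hy : condEnt q y p = condEnt q y x) (hv : S → α') (hhv : Det h hv) :
    condMI q f (fun s => (g s, y s)) h ≤
      condMI q f g h + (condEnt q y hv - condEnt q y x) := by
  -- The chain rule gives the increment I(f;y|g,h) = H(y|g,h) - H(y|f,g,h). The freedom in `hv`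
  -- serves two purposes: a constant makes the bound I(x;y), and the input itself makes it 0.
  have h₁ : condEnt q y (fun s => (g s, h s)) ≤ condEnt q y hv :=
    condEnt_anti hq y ((Det.comp Prod.snd).trans hhv)
  have h₂ : condEnt q y p ≤ condEnt q y (fun s => (f s, g s, h s)) :=
    condEnt_anti hq y (hf.pair (hg.pair hh))
  have e₁ : ent q (fun s => (f s, (g s, y s), h s)) = ent q (fun s => (y s, f s, g s, h s)) :=
    ent_congr q (fun s t e => by simp_all) (fun s t e => by simp_all)
  have e₂ : ent q (fun s => ((g s, y s), h s)) = ent q (fun s => (y s, g s, h s)) :=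
    ent_congr q (fun s t e => by simp_all) (fun s t e => by simp_all)
  rw [condMI_eq, condMI_eq, e₁, e₂]
  rw [hy] at h₂
  unfold condEnt at *
  linarith

/-- The increase of the conditional mutual information in a channel use, when a second output is
revealed to the side that is conditioned on. -/
theorem condMI_channel_pair_le {q : S → ℝ} (hq : ∀ s, 0 ≤ q s) {f : S → α} {g : S → β} {h : S → γ}
    {x : S → δ} {y : S → ε} {y' : S → α'} {p : S → ε'} (hf : Det p f) (hg : Det p g) (hh : Det p h)
    (hpx : Det p x) (hx : Det (fun s => (f s, h s)) x)
    (hy : condEnt q (fun s => (y s, y' s)) p = condEnt q (fun s => (y s, y' s)) x) :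
    condMI q f (fun s => (g s, y s)) (fun s => (h s, y' s)) ≤
      condMI q f g h + (condEnt q y y' - condEnt q y (fun s => (x s, y' s))) := by
  have hy' : condEnt q y' p = condEnt q y' x := condEnt_past_of_det hq hpx (Det.comp Prod.snd) hy
  -- the second output is conditionally independent of `g` given `f` and `h`
  have h₁ : condEnt q y' (fun s => (f s, h s)) ≤ condEnt q y' (fun s => (f s, g s, h s)) := by
    have a₁ := condEnt_anti hq y' hx
    have a₂ : condEnt q y' p ≤ condEnt q y' (fun s => (f s, g s, h s)) :=
      condEnt_anti hq y' (hf.pair (hg.pair hh))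
    linarith
  -- The chain rule splits the left side into I(f;g|h,y') + I(f;y|g,h,y'). With `h₁`, this
  -- inequality bounds the first term by I(f;g|h); `h₃`, `h₄` and `h₅` bound the second by
  -- I(x;y|y').
  have h₂ : condEnt q g (fun s => (h s, y' s)) ≤ condEnt q g h :=
    condEnt_anti hq g (Det.comp Prod.fst)
  have h₃ : condEnt q y (fun s => (g s, h s, y' s)) ≤ condEnt q y y' :=
    condEnt_anti hq y fun s t e => by simp_all
  have h₄ : condEnt q y (fun s => (p s, y' s)) ≤ condEnt q y (fun s => (f s, g s, h s, y' s)) := by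
    refine condEnt_anti hq y fun s t e => ?_
    have := hf s t; have := hg s t; have := hh s t
    simp_all
  have h₅ : condEnt q y (fun s => (p s, y' s)) = condEnt q y (fun s => (x s, y' s)) := by
    have e₁ : ent q (fun s => (y s, p s, y' s)) = ent q (fun s => ((y s, y' s), p s)) :=
      ent_congr q (fun s t e => by simp_all) (fun s t e => by simp_all)
    have e₂ : ent q (fun s => (y s, x s, y' s)) = ent q (fun s => ((y s, y' s), x s)) :=
      ent_congr q (fun s t e => by simp_all) (fun s t e => by simp_all)
    have e₃ : ent q (fun s => (p s, y' s)) = ent q (fun s => (y' s, p s)) :=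
      ent_congr q (fun s t e => by simp_all) (fun s t e => by simp_all)
    have e₄ : ent q (fun s => (x s, y' s)) = ent q (fun s => (y' s, x s)) :=
      ent_congr q (fun s t e => by simp_all) (fun s t e => by simp_all)
    unfold condEnt at *
    linarith
  have e₁ : ent q (fun s => (f s, h s, y' s)) = ent q (fun s => (y' s, f s, h s)) :=
    ent_congr q (fun s t e => by simp_all) (fun s t e => by simp_all)
  have e₂ : ent q (fun s => (f s, g s, h s, y' s)) = ent q (fun s => (y' s, f s, g s, h s)) :=
    ent_congr q (fun s t e => by simp_all) (fun s t e => by simp_all)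
  have e₃ : ent q (fun s => (f s, (g s, y s), h s, y' s)) =
      ent q (fun s => (y s, f s, g s, h s, y' s)) :=
    ent_congr q (fun s t e => by simp_all) (fun s t e => by simp_all)
  have e₄ : ent q (fun s => ((g s, y s), h s, y' s)) = ent q (fun s => (y s, g s, h s, y' s)) :=
    ent_congr q (fun s t e => by simp_all) (fun s t e => by simp_all)
  rw [condMI_eq, condMI_eq, e₁, e₃, e₄]
  unfold condEnt at *
  linarith

/-- A key that the left side shares with the right side is bounded by their mutual information. -/
theorem condEnt_le_condEnt_add_condMI {q : S → ℝ} (hq : ∀ s, 0 ≤ q s) {f : S → α} {g : S → β}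
    {h : S → γ} {z : S → δ} {k : S → ε} (hz : Det g z) (hk : Det (fun s => (f s, z s)) k) :
    condEnt q k (fun s => (z s, h s)) ≤ condEnt q k (fun s => (g s, h s)) + condMI q f g h := by
  -- The chain is I(k;g|z,h) ≤ I(f;g|z,h) ≤ I(f;g|h): the key is a function of (f, z), and `z` is a
  -- function of `g`.
  have h₁ : condEnt q f (fun s => (z s, h s)) ≤ condEnt q f h :=
    condEnt_anti hq f (Det.comp Prod.snd)
  have h₂ : condEnt q f (fun s => (k s, g s, h s)) ≤ condEnt q f (fun s => (k s, z s, h s)) := by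
    refine condEnt_anti hq f fun s t e => ?_
    have := hz s t
    simp_all
  have e₁ : ent q (fun s => (f s, k s, g s, h s)) = ent q (fun s => (f s, g s, h s)) := by
    refine ent_congr q (fun s t e => ?_) (fun s t e => ?_) <;>
      have a₁ := hz s t <;> have a₂ := hk s t <;> simp_all
  have e₂ : ent q (fun s => (f s, k s, z s, h s)) = ent q (fun s => (f s, z s, h s)) := by
    refine ent_congr q (fun s t e => ?_) (fun s t e => ?_) <;>
      have a₂ := hk s t <;> simp_all
  rw [condMI_eq]
  unfold condEnt at *
  linarith

theorem condMI_eq_zero_of_mass {q : S → ℝ} (hq : ∀ s, 0 ≤ q s) (hq₁ : ∑ s, q s = 1)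
    {f : S → α} {g : S → β}
    (h : ∀ a b, mass q (fun s => (f s, g s)) (a, b) = mass q f a * mass q g b) (c : γ) :
    condMI q f g (fun _ => c) = 0 := by
  have e₁ : ent q (fun s => (f s, c)) = ent q f :=
    ent_congr q (Det.comp Prod.fst) (Det.comp fun a => (a, c))
  have e₂ : ent q (fun s => (g s, c)) = ent q g :=
    ent_congr q (Det.comp Prod.fst) (Det.comp fun a => (a, c))
  have e₃ : ent q (fun s => (f s, g s, c)) = ent q (fun s => (f s, g s)) :=
    ent_congr q (fun s t e => by simp_all) (fun s t e => by simp_all)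
  have e₄ : ent q (fun s => (f s, g s)) = ent q f + ent q g := by
    unfold ent
    rw [← neg_add, ← Finset.sum_add_distrib]
    congr 1
    refine Finset.sum_congr rfl fun s _ => ?_
    rcases (hq s).eq_or_lt with hs | hs
    · simp [← hs]
    · rw [h, Real.log_mul (mass_pos hq f hs).ne' (mass_pos hq g hs).ne', mul_add]
  rw [condMI_eq, ent_const hq₁, e₁, e₂, e₃, e₄]
  ring

/-- The equivocation of a sequence is at most the sum of the equivocations of its terms. -/
theorem condEnt_prefix_le {n : ℕ} {q : S → ℝ} (hq : ∀ s, 0 ≤ q s) (hq₁ : ∑ s, q s = 1)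
    (x : S → Fin n → α) (y : S → Fin n → β) {c : ℝ}
    (hc : ∀ l, condEnt q (fun s => x s l) (fun s => y s l) ≤ c) :
    condEnt q x y ≤ n * c := by
  have key : ∀ l ≤ n, condEnt q (fun s (t : {t : Fin n // (t : ℕ) < l}) => x s t)
      (fun s (t : {t : Fin n // (t : ℕ) < l}) => y s t) ≤ l * c := by
    intro l
    induction l with
    | zero =>
      intro _
      unfold condEnt
      rw [ent_congr q (g := fun _ => ()), ent_congr q (f := fun s (t : {t : Fin n // (t : ℕ) < 0})
        => y s t) (g := fun _ => ()), ent_const hq₁]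
      · simp
      · exact fun _ _ _ => rfl
      · exact fun _ _ _ => funext fun t => absurd t.2 (Nat.not_lt_zero _)
      · exact fun _ _ _ => rfl
      · exact fun _ _ _ => Prod.ext (funext fun t => absurd t.2 (Nat.not_lt_zero _))
          (funext fun t => absurd t.2 (Nat.not_lt_zero _))
    | succ l ih =>
      intro hl
      have h₀ := ih (by omega)
      have h₁ := hc ⟨l, hl⟩
      set X : S → ({t : Fin n // (t : ℕ) < l} → α) := fun s t => x s t
      set Y : S → ({t : Fin n // (t : ℕ) < l} → β) := fun s t => y s t
      set X' : S → ({t : Fin n // (t : ℕ) < l + 1} → α) := fun s t => x s t with hX'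
      set Y' : S → ({t : Fin n // (t : ℕ) < l + 1} → β) := fun s t => y s t with hY'
      have dX : Det X' X := fun s t e => funext fun i => congrFun e ⟨i.1, i.2.trans l.lt_succ_self⟩
      have dY : Det Y' Y := fun s t e => funext fun i => congrFun e ⟨i.1, i.2.trans l.lt_succ_self⟩
      have dy : Det Y' fun s => y s ⟨l, hl⟩ :=
        fun s t e => congrFun e ⟨⟨l, hl⟩, l.lt_succ_self⟩
      have dX' : Det (fun s => (X s, x s ⟨l, hl⟩)) X' := by
        intro s t e
        funext i
        rcases Nat.lt_succ_iff_lt_or_eq.1 i.2 with h | h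
        · exact congrFun (congrArg Prod.fst e) ⟨i.1, h⟩
        · have : i.1 = ⟨l, hl⟩ := Fin.ext h
          simp only [hX', this]
          exact congrArg Prod.snd e
      -- Chain rule for the longer prefix: the older inputs need only the older outputs, the new
      -- input only its own output; all other conditioning is dropped.
      have a₁ : condEnt q X Y' ≤ condEnt q X Y := condEnt_anti hq X dY
      have a₂ : condEnt q (fun s => x s ⟨l, hl⟩) (fun s => (X s, Y' s)) ≤
          condEnt q (fun s => x s ⟨l, hl⟩) (fun s => y s ⟨l, hl⟩) :=
        condEnt_anti hq _ ((Det.comp Prod.snd).trans dy)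
      have a₃ : ent q (fun s => (X' s, Y' s)) ≤ ent q (fun s => (x s ⟨l, hl⟩, X s, Y' s)) := by
        refine ent_mono hq fun s t e => ?_
        have := dX' s t
        simp_all
      unfold condEnt at *
      push_cast
      linarith
  refine le_trans (le_of_eq ?_) (key n le_rfl)
  unfold condEnt
  rw [ent_congr q (f := y) (g := fun s (t : {t : Fin n // (t : ℕ) < n}) => y s t),
    ent_congr q (f := fun s => (x s, y s)) (g := fun s =>
      ((fun t => x s t : {t : Fin n // (t : ℕ) < n} → α),
       (fun t => y s t : {t : Fin n // (t : ℕ) < n} → β)))]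
  · exact fun s t e => by simp_all
  · exact fun s t e => Prod.ext (funext fun i => congrFun (congrArg Prod.fst e) ⟨i, i.2⟩)
      (funext fun i => congrFun (congrArg Prod.snd e) ⟨i, i.2⟩)
  · exact fun s t e => by simp_all
  · exact fun s t e => funext fun i => congrFun e ⟨i, i.2⟩

end FiniteEntropy

/-! ### Protocols over a finite space of outcomes -/

namespace FiniteEntropy

variable {S α β γ : Type*}

theorem det_take_of_le {n : ℕ} (y : S → Fin n → α) {l l' : ℕ} (h : l ≤ l') :
    Det (fun s => (List.ofFn (y s)).take l') (fun s => (List.ofFn (y s)).take l) := by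
  intro s t e
  have := congrArg (List.take l) e
  simpa [List.take_take, min_eq_left h] using this

theorem take_ofFn_succ {n : ℕ} (y : Fin n → α) (l : Fin n) :
    (List.ofFn y).take (l + 1) = (List.ofFn y).take l ++ [y l] := by
  rw [List.take_add_one]
  simp

theorem det_take_succ {n : ℕ} (y : S → Fin n → α) (l : Fin n) :
    Det (fun s => ((List.ofFn (y s)).take l, y s l)) (fun s => (List.ofFn (y s)).take (l + 1)) := by
  intro s t e
  simp only [Prod.mk.injEq] at e
  simp only [take_ofFn_succ, e.1, e.2]

theorem det_apply_of_take_succ {n : ℕ} (y : S → Fin n → α) (l : Fin n) :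
    Det (fun s => (List.ofFn (y s)).take (l + 1)) (fun s => y s l) := by
  intro s t e
  simp only [take_ofFn_succ] at e
  simpa using (List.append_inj' e rfl).2

theorem det_of_take {n : ℕ} (y : S → Fin n → α) : Det (fun s => (List.ofFn (y s)).take n) y := by
  intro s t e
  have h : ∀ s, (List.ofFn (y s)).take n = List.ofFn (y s) :=
    fun s => List.take_of_length_le (by simp)
  simp only [h] at e
  exact List.ofFn_injective e

theorem take_ofFn_congr {n : ℕ} {y y' : Fin n → α} {l : ℕ}
    (h : ∀ t : Fin n, (t : ℕ) < l → y t = y' t) :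
    (List.ofFn y).take l = (List.ofFn y').take l := by
  refine List.ext_getElem (by simp) fun i h₁ h₂ => ?_
  simp only [List.length_take, List.length_ofFn, lt_min_iff] at h₁
  simp [h ⟨i, h₁.2⟩ h₁.1]

variable [Fintype S]

/-- The right-hand side depends on `p` only through the kernel values `w`. Two conditionings under
which `y` has the same transition probabilities therefore give the same conditional entropy. -/
theorem condEnt_of_kernel {q : S → ℝ} (hq : ∀ s, 0 ≤ q s) {y : S → α} {p : S → β} {w : S → ℝ}
    (h : ∀ s, mass q (fun s => (p s, y s)) (p s, y s) = mass q p (p s) * w s) :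
    condEnt q y p = -∑ s, q s * Real.log (w s) := by
  have e : ent q (fun s => (y s, p s)) = ent q (fun s => (p s, y s)) :=
    ent_congr q (fun s t e => by simp_all) (fun s t e => by simp_all)
  have : ∀ s, q s * Real.log (mass q p (p s) * w s) =
      q s * Real.log (mass q p (p s)) + q s * Real.log (w s) := by
    intro s
    rcases (hq s).eq_or_lt with hs | hs
    · simp [← hs]
    · have h₁ := mass_pos hq p hs
      have h₂ := mass_pos hq (fun s => (p s, y s)) hs
      rw [h] at h₂
      rw [Real.log_mul h₁.ne' (pos_of_mul_pos_right h₂ h₁.le).ne', mul_add]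
  rw [condEnt, e]
  unfold ent
  simp only [h, this, Finset.sum_add_distrib]
  ring

end FiniteEntropy

open FiniteEntropy

namespace OTProtocol

variable {𝒳 : Type*} {𝒴 : Fin 2 → Type*} [MeasurableSpace 𝒳] {n : ℕ} {k : Fin 2 → ℕ}

theorem transcript_congr (π : OTProtocol 𝒳 𝒴 n k) (i : Fin 2) (m : OTStrings k) (z : Bool)
    (rA : π.RandA) (rB : π.RandB i) {y y' : Fin n → 𝒴 i} (l : ℕ)
    (h : (List.ofFn y).take l = (List.ofFn y').take l) :
    π.transcript i m z rA rB y l = π.transcript i m z rA rB y' l := by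
  induction l with
  | zero => rfl
  | succ l ih =>
    have := congrArg (List.take l) h
    simp only [List.take_take, min_eq_left l.le_succ] at this
    simp only [transcript, h, ih this]

/-- Everything that is random in a protocol: the strings, the choice bits, the private randomness
and the channel outputs. -/
abbrev Outcome (π : OTProtocol 𝒳 𝒴 n k) : Type _ :=
  OTStrings k × (Fin 2 → Bool) × π.RandA × (∀ i, π.RandB i) × (Fin n → ∀ i, 𝒴 i)

/-- The channel inputs. -/
def inputs (π : OTProtocol 𝒳 𝒴 n k) (s : π.Outcome) : Fin n → 𝒳 :=
  π.channelInput s.1 s.2.1 s.2.2.1 s.2.2.2.1 s.2.2.2.2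

/-- The channel outputs. -/
def outputs (π : OTProtocol 𝒳 𝒴 n k) (s : π.Outcome) : Fin n → ∀ i, 𝒴 i := s.2.2.2.2

/-- The transcript of link `i` after session `l`. -/
def link (π : OTProtocol 𝒳 𝒴 n k) (i : Fin 2) (l : ℕ) (s : π.Outcome) : List (Fin π.msgCard) :=
  π.transcript i s.1 (s.2.1 i) s.2.2.1 (s.2.2.2.1 i) (fun t => s.2.2.2.2 t i) l

/-- The transcript of link `i` before session `l`. -/
def linkBefore (π : OTProtocol 𝒳 𝒴 n k) (i : Fin 2) :
    ℕ → π.Outcome → List (Fin π.msgCard)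
  | 0, _ => []
  | l + 1, s => π.link i l s

/-- Alice's private data. -/
def alice (π : OTProtocol 𝒳 𝒴 n k) (s : π.Outcome) : OTStrings k × π.RandA := (s.1, s.2.2.1)

/-- The private data of Bob-`i` after `l` channel uses. -/
def bob (π : OTProtocol 𝒳 𝒴 n k) (i : Fin 2) (l : ℕ) (s : π.Outcome) :
    Bool × π.RandB i × List (𝒴 i) :=
  (s.2.1 i, s.2.2.2.1 i, (List.ofFn fun t => s.2.2.2.2 t i).take l)

/-- Everything generated before the `l`-th channel use. -/
def past (π : OTProtocol 𝒳 𝒴 n k) (l : Fin n) (s : π.Outcome) :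
    OTStrings k × (Fin 2 → Bool) × π.RandA × (∀ i, π.RandB i) × (Set.Iio l → ∀ i, 𝒴 i) :=
  (s.1, s.2.1, s.2.2.1, s.2.2.2.1, fun t => s.2.2.2.2 t)

variable (π : OTProtocol 𝒳 𝒴 n k)

theorem link_eq_exchange (i : Fin 2) (l : ℕ) (s : π.Outcome) :
    π.link i l s = exchange (π.aliceMsg i s.1 s.2.2.1)
      (π.bobMsg i (s.2.1 i) (s.2.2.2.1 i) ((List.ofFn fun t => s.2.2.2.2 t i).take l))
      (π.rounds i l) (π.linkBefore i l s) := by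
  cases l <;> rfl

theorem det_past_alice (l : Fin n) : Det (π.past l) π.alice := by
  intro s t e
  simp only [past, Prod.mk.injEq] at e
  simp [alice, e]

theorem det_past_bob (l : Fin n) (i : Fin 2) : Det (π.past l) (π.bob i l) := by
  intro s t e
  simp only [past, Prod.mk.injEq] at e
  simp only [bob, e.2.1, e.2.2.2.1, Prod.mk.injEq, true_and]
  exact take_ofFn_congr fun u hu => congrFun (congrFun e.2.2.2.2 ⟨u, hu⟩) i

theorem det_link (i : Fin 2) (l : ℕ) : Det (fun s => (π.alice s, π.bob i l s)) (π.link i l) := by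
  intro s t e
  simp only [alice, bob, Prod.mk.injEq] at e
  simp only [link, e.1.1, e.1.2, e.2.1, e.2.2.1]
  exact transcript_congr _ _ _ _ _ _ _ e.2.2.2

theorem det_past_link (l : Fin n) (i : Fin 2) : Det (π.past l) (π.link i l) :=
  ((π.det_past_alice l).pair (π.det_past_bob l i)).trans (π.det_link i l)

theorem forall_fin_two_rev {P : Fin 2 → Prop} (i : Fin 2) (h : P i) (h' : P i.rev) (j : Fin 2) :
    P j := by
  fin_cases i <;> fin_cases j <;> assumption

theorem det_inputs (l : Fin n) (i : Fin 2) :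
    Det (fun s => (π.alice s, π.link i l s, π.link i.rev l s)) fun s => π.inputs s l := by
  intro s t e
  simp only [alice, Prod.mk.injEq] at e
  simp only [inputs, channelInput, e.1.1, e.1.2]
  congr 1
  funext j
  have := forall_fin_two_rev (P := fun j => π.link j l s = π.link j l t) i e.2.1 e.2.2 j
  simpa only [link, e.1.1, e.1.2] using this

theorem det_past_inputs (l : Fin n) : Det (π.past l) fun s => π.inputs s l :=
  ((π.det_past_alice l).pair ((π.det_past_link l 0).pair (π.det_past_link l (Fin.rev 0)))).trans
    (π.det_inputs l 0)

theorem det_bob_succ (i : Fin 2) (l : Fin n) :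
    Det (fun s => (π.bob i l s, π.outputs s l i)) (π.bob i (l + 1)) := by
  intro s t e
  have := det_take_succ (fun s : π.Outcome => fun t => s.2.2.2.2 t i) l s t
  simp only [bob, outputs, Prod.mk.injEq] at *
  tauto

theorem det_bob_of_succ (i : Fin 2) (l : Fin n) :
    Det (π.bob i (l + 1)) (fun s => (π.bob i l s, π.outputs s l i)) := by
  intro s t e
  have h₁ := det_apply_of_take_succ (fun s : π.Outcome => fun t => s.2.2.2.2 t i) l s t
  have h₂ := det_take_of_le (fun s : π.Outcome => fun t => s.2.2.2.2 t i) l.1.le_succ s t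
  simp only [bob, outputs, Prod.mk.injEq] at *
  tauto

theorem det_initial_bob (i : Fin 2) :
    Det (fun s : π.Outcome => (s.2.1, s.2.2.2.1)) (π.bob i 0) := by
  intro s t e
  simp only [Prod.mk.injEq] at e
  simp [bob, e]

theorem det_past_bobs (l : Fin n) :
    Det (π.past l) (fun s => (π.bob 0 l s, π.bob 1 l s)) :=
  (π.det_past_bob l 0).pair (π.det_past_bob l 1)

theorem det_bobs_succ (l : Fin n) :
    Det (fun s => ((π.bob 0 l s, π.bob 1 l s), π.outputs s l))
      (fun s => (π.bob 0 (l + 1) s, π.bob 1 (l + 1) s)) := by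
  intro s t e
  have a₁ := π.det_bob_succ 0 l s t
  have a₂ := π.det_bob_succ 1 l s t
  simp_all

theorem det_bobs_of_succ (l : Fin n) :
    Det (fun s => (π.bob 0 (l + 1) s, π.bob 1 (l + 1) s))
      (fun s => ((π.bob 0 l s, π.bob 1 l s), π.outputs s l)) := by
  intro s t e
  have a₁ := π.det_bob_of_succ 0 l s t
  have a₂ := π.det_bob_of_succ 1 l s t
  simp only [Prod.mk.injEq] at *
  exact ⟨⟨(a₁ e.1).1, (a₂ e.2).1⟩, funext (Fin.forall_fin_two.2 ⟨(a₁ e.1).2, (a₂ e.2).2⟩)⟩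

variable [∀ i, Fintype (𝒴 i)] [Fintype π.RandA] [∀ i, Fintype (π.RandB i)]

/-- The weights `q` are the joint law of the random variables of a run of `π` over `W`. -/
structure IsRunLaw (W : 𝒳 → PMF (∀ i, 𝒴 i)) (q : π.Outcome → ℝ) : Prop where
  nonneg : ∀ s, 0 ≤ q s
  sum_eq_one : ∑ s, q s = 1
  uniform : ∀ p, mass q (fun s => (s.1, s.2.1)) p =
    (Fintype.card (OTStrings k × (Fin 2 → Bool)) : ℝ)⁻¹
  indep : ∀ a b, mass q (fun s => (π.alice s, s.2.1, s.2.2.2.1)) (a, b) =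
    mass q π.alice a * mass q (fun s => (s.2.1, s.2.2.2.1)) b
  channel_past : ∀ l s, mass q (fun s => (π.past l s, π.outputs s l)) (π.past l s, π.outputs s l) =
    mass q (π.past l) (π.past l s) * (W (π.inputs s l) (π.outputs s l)).toReal
  channel_input : ∀ l x y, mass q (fun s => (π.inputs s l, π.outputs s l)) (x, y) =
    mass q (fun s => π.inputs s l) x * (W x y).toReal

variable {π} {W : 𝒳 → PMF (∀ i, 𝒴 i)} {q : π.Outcome → ℝ}

/-! ### Growth of the shared information along a protocol. -/

namespace IsRunLaw

/-- Memorylessness in entropy form: given the whole past or only the current input, the output is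
governed by the same kernel `W`. -/
theorem condEnt_outputs_past (hq : π.IsRunLaw W q) (l : Fin n) :
    condEnt q (fun s => π.outputs s l) (π.past l) =
      condEnt q (fun s => π.outputs s l) (fun s => π.inputs s l) := by
  rw [condEnt_of_kernel hq.nonneg (hq.channel_past l),
    condEnt_of_kernel hq.nonneg fun s => hq.channel_input l (π.inputs s l) (π.outputs s l)]

theorem condEnt_output_past (hq : π.IsRunLaw W q) (l : Fin n) (i : Fin 2) :
    condEnt q (fun s => π.outputs s l i) (π.past l) =
      condEnt q (fun s => π.outputs s l i) (fun s => π.inputs s l) :=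
  condEnt_past_of_det hq.nonneg (π.det_past_inputs l) (fun _ _ e => congrFun e i)
    (hq.condEnt_outputs_past l)

/-- A session on one link does not increase the conditional mutual information. -/
theorem condMI_link_le (hq : π.IsRunLaw W q) {β δ : Type*} (i : Fin 2) (l : ℕ)
    (g : π.Outcome → β) (d : π.Outcome → δ) (hg : Det (fun s => (g s, d s)) (π.bob i l)) :
    condMI q π.alice g (fun s => (π.link i l s, d s)) ≤
      condMI q π.alice g (fun s => (π.linkBefore i l s, d s)) := by
  simp only [link_eq_exchange]
  refine condMI_exchange_le hq.nonneg π.alice g d _ _ (π.linkBefore i l) ?_ ?_ _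
  · intro s t e
    simp only [alice, Prod.mk.injEq] at e
    simp only [e.1, e.2]
  · intro s t e
    have := hg s t e
    simp only [bob, Prod.mk.injEq] at this
    simp only [this.1, this.2.1, this.2.2]

/-- A session on both links does not increase the conditional mutual information. -/
theorem condMI_links_le (hq : π.IsRunLaw W q) {β δ : Type*} (i : Fin 2) (l : ℕ)
    (g : π.Outcome → β) (d : π.Outcome → δ) (hg : Det (fun s => (g s, d s)) (π.bob i l))
    (hg' : Det (fun s => (g s, d s)) (π.bob i.rev l)) :
    condMI q π.alice g (fun s => (π.link i l s, π.link i.rev l s, d s)) ≤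
      condMI q π.alice g (fun s => (π.linkBefore i l s, π.linkBefore i.rev l s, d s)) := by
  -- The two links are undone one at a time. While link i is undone, the finished transcript of the
  -- other link is mere side information, because messages on link i do not depend on it; then the
  -- other link is undone.
  refine (hq.condMI_link_le i l g (fun s => (π.link i.rev l s, d s)) ?_).trans ?_
  · intro s t e
    have := hg s t
    simp_all
  have h₁ := hq.condMI_link_le i.rev l g (fun s => (π.linkBefore i l s, d s)) (by
    intro s t e
    have := hg' s t
    simp_all)
  rw [condMI_congr q π.alice (h := fun s => (π.link i.rev l s, π.linkBefore i l s, d s))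
      (h' := fun s => (π.linkBefore i l s, π.link i.rev l s, d s)) (g' := g)] at h₁
  · rw [condMI_congr q π.alice
      (h := fun s => (π.linkBefore i.rev l s, π.linkBefore i l s, d s))
      (h' := fun s => (π.linkBefore i l s, π.linkBefore i.rev l s, d s)) (g' := g)] at h₁
    · exact h₁
    all_goals exact fun s t e => by simp_all
  all_goals exact fun s t e => by simp_all

theorem condMI_initial (hq : π.IsRunLaw W q) {γ : Type*} (c : γ) :
    condMI q π.alice (fun s => (s.2.1, s.2.2.2.1)) (fun _ => c) = 0 :=
  condMI_eq_zero_of_mass hq.nonneg hq.sum_eq_one hq.indep c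

/-- Alice's data are independent of the Bobs' initial data. Revealing part of the latter acts like a
message from the Bobs, and the rest stays independent of Alice. -/
theorem condMI_initial_le (hq : π.IsRunLaw W q) {β γ : Type*} {g : π.Outcome → β}
    {h : π.Outcome → γ} (hg : Det (fun s : π.Outcome => (s.2.1, s.2.2.2.1)) g)
    (hh : Det (fun s : π.Outcome => (s.2.1, s.2.2.2.1)) h) : condMI q π.alice g h ≤ 0 := by
  have h₀ := hq.condMI_initial ()
  have h₁ := condMI_le_of_det_right hq.nonneg π.alice (fun s : π.Outcome => (s.2.1, s.2.2.2.1))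
    (h := fun _ => ()) (h' := h) (fun _ _ _ => rfl) ((Det.comp Prod.fst).trans hh)
  have h₂ : condEnt q π.alice (fun s : π.Outcome => ((s.2.1, s.2.2.2.1), h s)) ≤
      condEnt q π.alice (fun s => (g s, h s)) :=
    condEnt_anti hq.nonneg _ (((Det.comp Prod.fst).trans hg).pair (Det.comp Prod.snd))
  unfold condMI at *
  linarith

/-- The information that Alice and Bob-`i` share beyond the transcript of their link. -/
theorem condMI_link_bound (hq : π.IsRunLaw W q) (i : Fin 2) {c : ℝ}
    (hc : ∀ l, ent q (fun s => π.outputs s l i) -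
      condEnt q (fun s => π.outputs s l i) (fun s => π.inputs s l) ≤ c) {l : ℕ} (hl : l ≤ n) :
    condMI q π.alice (π.bob i l) (π.link i l) ≤ l * c := by
  have session : ∀ l, condMI q π.alice (π.bob i l) (π.link i l) ≤
      condMI q π.alice (π.bob i l) (π.linkBefore i l) := by
    intro l
    have h := hq.condMI_link_le i l (π.bob i l) (fun _ => ()) (Det.comp Prod.fst)
    rw [condMI_congr q π.alice (h' := π.link i l) (g' := π.bob i l),
      condMI_congr q π.alice (h := fun s => (π.linkBefore i l s, ()))
        (h' := π.linkBefore i l) (g' := π.bob i l)] at h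
    · exact h
    all_goals exact fun s t e => by simp_all
  induction l with
  | zero =>
    refine (session 0).trans ((hq.condMI_initial_le (π.det_initial_bob i) ?_).trans (by simp))
    exact fun _ _ _ => rfl
  | succ l ih =>
    have h₁ := ih (by omega)
    have h₂ := hc ⟨l, hl⟩
    have h₃ := condMI_channel_le hq.nonneg (π.det_past_alice ⟨l, hl⟩) (π.det_past_bob ⟨l, hl⟩ i)
      (π.det_past_link ⟨l, hl⟩ i) (hq.condEnt_output_past ⟨l, hl⟩ i) (fun _ => ())
      (fun _ _ _ => rfl)
    have e₁ : condEnt q (fun s => π.outputs s ⟨l, hl⟩ i) (fun _ => ()) =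
        ent q (fun s => π.outputs s ⟨l, hl⟩ i) := by
      rw [condEnt, ent_const hq.sum_eq_one, sub_zero]
      exact ent_congr q (Det.comp Prod.fst) (Det.comp fun a => (a, ()))
    have e₂ : condMI q π.alice (π.bob i (l + 1)) (π.link i l) =
        condMI q π.alice (fun s => (π.bob i l s, π.outputs s ⟨l, hl⟩ i)) (π.link i l) :=
      condMI_congr q _ (fun _ _ e => e) (fun _ _ e => e)
        ((Det.comp Prod.fst).trans (π.det_bob_of_succ i ⟨l, hl⟩))
        ((Det.comp Prod.fst).trans (π.det_bob_succ i ⟨l, hl⟩))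
    have h₄ := session (l + 1)
    rw [show π.linkBefore i (l + 1) = π.link i l from rfl, e₂] at h₄
    push_cast
    linarith

/-- The information that Alice and Bob-`i` share beyond the view of the other Bob. -/
theorem condMI_bob_bound (hq : π.IsRunLaw W q) (i : Fin 2) {c : ℝ}
    (hc : ∀ l, condEnt q (fun s => π.outputs s l i) (fun s => π.outputs s l i.rev) -
      condEnt q (fun s => π.outputs s l i) (fun s => (π.inputs s l, π.outputs s l i.rev)) ≤ c)
    {l : ℕ} (hl : l ≤ n) :
    condMI q π.alice (π.bob i l) (fun s => (π.link i l s, π.link i.rev l s, π.bob i.rev l s)) ≤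
      l * c := by
  have session : ∀ l, condMI q π.alice (π.bob i l)
      (fun s => (π.link i l s, π.link i.rev l s, π.bob i.rev l s)) ≤
      condMI q π.alice (π.bob i l)
        (fun s => (π.linkBefore i l s, π.linkBefore i.rev l s, π.bob i.rev l s)) := by
    exact fun l => hq.condMI_links_le i l (π.bob i l) (π.bob i.rev l) (Det.comp Prod.fst)
      (Det.comp Prod.snd)
  induction l with
  | zero =>
    refine (session 0).trans ((hq.condMI_initial_le (π.det_initial_bob i) ?_).trans (by simp))
    intro s t e
    have := π.det_initial_bob i.rev s t e
    simp_all [linkBefore]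
  | succ l ih =>
    have h₁ := ih (by omega)
    have h₂ := hc ⟨l, hl⟩
    -- Both transcripts are conditioned on because the input depends on both: together with Alice's
    -- data they determine it, so the other Bob's output carries no further dependence on Bob-i's
    -- past.
    have h₃ := condMI_channel_pair_le hq.nonneg (y := fun s => π.outputs s ⟨l, hl⟩ i)
      (y' := fun s => π.outputs s ⟨l, hl⟩ i.rev) (π.det_past_alice ⟨l, hl⟩)
      (π.det_past_bob ⟨l, hl⟩ i)
      (h := fun s => (π.link i l s, π.link i.rev l s, π.bob i.rev l s))
      ((π.det_past_link ⟨l, hl⟩ i).pair ((π.det_past_link ⟨l, hl⟩ i.rev).pair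
        (π.det_past_bob ⟨l, hl⟩ i.rev))) (π.det_past_inputs ⟨l, hl⟩) (fun s t e => by
          refine π.det_inputs ⟨l, hl⟩ i s t ?_
          simp_all)
      (condEnt_past_of_det hq.nonneg (π.det_past_inputs _) (fun s t e => by simp [e])
        (hq.condEnt_outputs_past ⟨l, hl⟩))
    have h₄ := session (l + 1)
    have e₂ : condMI q π.alice (π.bob i (l + 1)) (fun s => (π.linkBefore i (l + 1) s,
        π.linkBefore i.rev (l + 1) s, π.bob i.rev (l + 1) s)) =
        condMI q π.alice (fun s => (π.bob i l s, π.outputs s ⟨l, hl⟩ i))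
          (fun s => ((π.link i l s, π.link i.rev l s, π.bob i.rev l s),
            π.outputs s ⟨l, hl⟩ i.rev)) := by
      have a₁ := π.det_bob_succ i ⟨l, hl⟩
      have a₂ := π.det_bob_of_succ i ⟨l, hl⟩
      have a₃ := π.det_bob_succ i.rev ⟨l, hl⟩
      have a₄ := π.det_bob_of_succ i.rev ⟨l, hl⟩
      refine condMI_congr q _ (fun s t e => ?_) (fun s t e => ?_) (fun s t e => ?_)
        (fun s t e => ?_) <;>
      specialize a₁ s t <;> specialize a₂ s t <;> specialize a₃ s t <;> specialize a₄ s t <;>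
      simp_all [linkBefore]
    rw [e₂] at h₄
    push_cast
    linarith

/-- The information that Alice and the two Bobs share beyond the transcripts. -/
theorem condMI_bobs_bound (hq : π.IsRunLaw W q) {c : ℝ}
    (hc : ∀ l, ent q (fun s => π.outputs s l) -
      condEnt q (fun s => π.outputs s l) (fun s => π.inputs s l) ≤ c) {l : ℕ} (hl : l ≤ n) :
    condMI q π.alice (fun s => (π.bob 0 l s, π.bob 1 l s)) (fun s => (π.link 0 l s, π.link 1 l s)) ≤
      l * c := by
  have session : ∀ l, condMI q π.alice (fun s => (π.bob 0 l s, π.bob 1 l s))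
      (fun s => (π.link 0 l s, π.link 1 l s)) ≤
      condMI q π.alice (fun s => (π.bob 0 l s, π.bob 1 l s))
        (fun s => (π.linkBefore 0 l s, π.linkBefore 1 l s)) := by
    intro l
    have h := hq.condMI_links_le 0 l (fun s => (π.bob 0 l s, π.bob 1 l s)) (fun _ => ())
      (fun s t e => by simp_all) (fun s t e => by simp_all)
    rw [condMI_congr q π.alice (h' := fun s => (π.link 0 l s, π.link 1 l s))
        (g' := fun s => (π.bob 0 l s, π.bob 1 l s)),
      condMI_congr q π.alice
        (h := fun s => (π.linkBefore 0 l s, π.linkBefore (Fin.rev 0) l s, ()))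
        (h' := fun s => (π.linkBefore 0 l s, π.linkBefore 1 l s))
        (g' := fun s => (π.bob 0 l s, π.bob 1 l s))] at h
    · exact h
    all_goals exact fun s t e => by simp_all
  induction l with
  | zero =>
    refine (session 0).trans ((hq.condMI_initial_le
      ((π.det_initial_bob 0).pair (π.det_initial_bob 1)) ?_).trans (by simp))
    exact fun _ _ _ => rfl
  | succ l ih =>
    have h₁ := ih (by omega)
    have h₂ := hc ⟨l, hl⟩
    have h₃ := condMI_channel_le hq.nonneg (π.det_past_alice ⟨l, hl⟩) (π.det_past_bobs ⟨l, hl⟩)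
      ((π.det_past_link ⟨l, hl⟩ 0).pair (π.det_past_link ⟨l, hl⟩ 1))
      (hq.condEnt_outputs_past ⟨l, hl⟩) (fun _ => ()) (fun _ _ _ => rfl)
    have e₁ : condEnt q (fun s => π.outputs s ⟨l, hl⟩) (fun _ => ()) =
        ent q (fun s => π.outputs s ⟨l, hl⟩) := by
      rw [condEnt, ent_const hq.sum_eq_one, sub_zero]
      exact ent_congr q (Det.comp Prod.fst) (Det.comp fun a => (a, ()))
    have h₄ := session (l + 1)
    rw [condMI_congr q π.alice
      (g' := fun s => ((π.bob 0 l s, π.bob 1 l s), π.outputs s ⟨l, hl⟩))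
      (h := fun s => (π.linkBefore 0 (l + 1) s, π.linkBefore 1 (l + 1) s))
      (h' := fun s => (π.link 0 l s, π.link 1 l s))
      (fun _ _ e => e) (fun _ _ e => e) ((Det.comp Prod.fst).trans (π.det_bobs_of_succ ⟨l, hl⟩))
      ((Det.comp Prod.fst).trans (π.det_bobs_succ ⟨l, hl⟩))] at h₄
    push_cast
    linarith

/-- Given the channel inputs and the transcripts, Alice's data are independent of the data of
the two Bobs. -/
theorem condMI_inputs_le_zero (hq : π.IsRunLaw W q) {l : ℕ} (hl : l ≤ n) :
    condMI q π.alice (fun s => (π.bob 0 l s, π.bob 1 l s))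
      (fun s => (π.link 0 l s, π.link 1 l s, (List.ofFn (π.inputs s)).take l)) ≤ 0 := by
  have session : ∀ l, condMI q π.alice (fun s => (π.bob 0 l s, π.bob 1 l s))
      (fun s => (π.link 0 l s, π.link 1 l s, (List.ofFn (π.inputs s)).take l)) ≤
      condMI q π.alice (fun s => (π.bob 0 l s, π.bob 1 l s))
        (fun s => (π.linkBefore 0 l s, π.linkBefore 1 l s, (List.ofFn (π.inputs s)).take l)) :=
    fun l => hq.condMI_links_le 0 l (fun s => (π.bob 0 l s, π.bob 1 l s)) _
      (fun s t e => by simp_all) (fun s t e => by simp_all)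
  induction l with
  | zero =>
    refine (session 0).trans (hq.condMI_initial_le
      ((π.det_initial_bob 0).pair (π.det_initial_bob 1)) ?_)
    exact fun _ _ _ => by simp [linkBefore]
  | succ l ih =>
    have h₁ := ih (by omega)
    set l' : Fin n := ⟨l, hl⟩
    have dX := det_take_of_le (π.inputs) l.le_succ
    have dX' := det_take_succ π.inputs l'
    have dx := det_apply_of_take_succ π.inputs l'
    have dp : Det (π.past l') (fun s => (List.ofFn (π.inputs s)).take l) := by
      intro s t e
      refine take_ofFn_congr fun u hu => π.det_past_inputs u s t ?_
      simp only [past, Prod.mk.injEq] at e ⊢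
      exact ⟨e.1, e.2.1, e.2.2.1, e.2.2.2.1,
        funext fun v => congrFun e.2.2.2.2 ⟨v, lt_trans v.2 hu⟩⟩
    -- The new input is a function of Alice's data and the transcripts, so publishing it counts as
    -- one more message of Alice. It is published before its output is revealed to the Bobs.
    have h₂ : condMI q π.alice (fun s => (π.bob 0 l s, π.bob 1 l s))
        (fun s => (π.link 0 l s, π.link 1 l s, (List.ofFn (π.inputs s)).take (l + 1))) ≤
        condMI q π.alice (fun s => (π.bob 0 l s, π.bob 1 l s))
          (fun s => (π.link 0 l s, π.link 1 l s, (List.ofFn (π.inputs s)).take l)) := by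
      refine condMI_le_of_det_left hq.nonneg _ _ (fun s t e => ?_) (fun s t e => ?_)
      · have := dX s t
        simp_all
      · have a₁ := dX' s t
        have a₂ := π.det_inputs l' 0 s t
        simp only [Prod.mk.injEq] at e
        have a₃ := a₂ (by simp only [Prod.mk.injEq]; exact ⟨e.1, e.2.1, e.2.2.1⟩)
        simp only [Prod.mk.injEq]
        exact ⟨e.2.1, e.2.2.1, a₁ (Prod.ext e.2.2.2 a₃)⟩
    -- The current input is already public, so it can be taken as `hv` and the gain of the channel
    -- use vanishes.
    have h₃ := condMI_channel_le hq.nonneg (π.det_past_alice l') (π.det_past_bobs l')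
      (h := fun s => (π.link 0 l s, π.link 1 l s, (List.ofFn (π.inputs s)).take (l + 1)))
      (by
        intro s t e
        have a₁ := dX' s t (Prod.ext (dp s t e) (π.det_past_inputs l' s t e))
        have a₂ := π.det_past_link l' 0 s t e
        have a₃ := π.det_past_link l' 1 s t e
        simp only [Prod.mk.injEq]
        exact ⟨a₂, a₃, a₁⟩)
      (hq.condEnt_outputs_past l') (fun s => π.inputs s l')
      (fun s t e => dx s t (by simp only [Prod.mk.injEq] at e; exact e.2.2))
    have h₄ := session (l + 1)
    rw [condMI_congr q π.alice
      (g' := fun s => ((π.bob 0 l s, π.bob 1 l s), π.outputs s l'))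
      (h := fun s => (π.linkBefore 0 (l + 1) s, π.linkBefore 1 (l + 1) s,
        (List.ofFn (π.inputs s)).take (l + 1)))
      (h' := fun s => (π.link 0 l s, π.link 1 l s, (List.ofFn (π.inputs s)).take (l + 1)))
      (fun _ _ e => e) (fun _ _ e => e) ((Det.comp Prod.fst).trans (π.det_bobs_of_succ l'))
      ((Det.comp Prod.fst).trans (π.det_bobs_succ l'))] at h₄
    linarith

end IsRunLaw

end OTProtocol

/-! ### Single-letter bounds -/

namespace OTProtocol

/-- Lists of length at most `L`. -/
abbrev ShortList (a L : ℕ) : Type := {h : List (Fin a) // h.length ≤ L}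

noncomputable instance instFintypeShortList (a L : ℕ) : Fintype (ShortList a L) :=
  (List.finite_length_le (Fin a) L).fintype

/-- Truncation to length `L`. -/
def truncate {a : ℕ} (L : ℕ) (h : List (Fin a)) : ShortList a L :=
  ⟨h.take L, List.length_take_le L h⟩

/-- Truncation to `maxLength` gives the views a finite transcript alphabet; actual transcripts never
exceed that length, so nothing is lost. -/
theorem truncate_inj {a L : ℕ} {h h' : List (Fin a)} (hh : h.length ≤ L) (hh' : h'.length ≤ L)
    (e : truncate L h = truncate L h') : h = h' := by
  have := congrArg Subtype.val e
  simpa only [truncate, List.take_of_length_le hh, List.take_of_length_le hh'] using this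

/-- Negation of both choice bits. -/
def flipBits : Equiv.Perm (Fin 2 → Bool) := Equiv.piCongrRight fun _ => Equiv.boolNot

theorem length_exchange {α : Type*} (a b : List α → α) (r : ℕ) (h : List α) :
    (exchange a b r h).length = h.length + 2 * r := by
  induction r with
  | zero => rfl
  | succ r ih => simp only [exchange, List.length_append, List.length_singleton, ih]; ring

variable {𝒳 : Type*} {𝒴 : Fin 2 → Type*} [MeasurableSpace 𝒳] {n : ℕ} {k : Fin 2 → ℕ}

/-- A bound on the lengths of the transcripts. -/
def maxLength (π : OTProtocol 𝒳 𝒴 n k) : ℕ :=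
  ∑ i, ∑ l ∈ Finset.range (n + 1), 2 * π.rounds i l

theorem length_transcript (π : OTProtocol 𝒳 𝒴 n k) (i : Fin 2) (m : OTStrings k) (z : Bool)
    (rA : π.RandA) (rB : π.RandB i) (y : Fin n → 𝒴 i) (l : ℕ) :
    (π.transcript i m z rA rB y l).length = ∑ t ∈ Finset.range (l + 1), 2 * π.rounds i t := by
  induction l with
  | zero => simp [transcript, length_exchange]
  | succ l ih => rw [Finset.sum_range_succ, transcript, length_exchange, ih]

theorem length_transcript_le (π : OTProtocol 𝒳 𝒴 n k) (i : Fin 2) (m : OTStrings k) (z : Bool)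
    (rA : π.RandA) (rB : π.RandB i) (y : Fin n → 𝒴 i) {l : ℕ} (hl : l ≤ n) :
    (π.transcript i m z rA rB y l).length ≤ π.maxLength := by
  rw [length_transcript]
  refine (Finset.sum_le_sum_of_subset (Finset.range_mono (Nat.succ_le_succ hl))).trans ?_
  exact Finset.single_le_sum (f := fun i => ∑ l ∈ Finset.range (n + 1), 2 * π.rounds i l)
    (fun _ _ => Nat.zero_le _) (Finset.mem_univ i)

/-! ### Strings, estimates and final views as functions of the outcome. -/

variable (π : OTProtocol 𝒳 𝒴 n k)

/-- The string chosen by Bob-`i`. -/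
def chosenString (i : Fin 2) (s : π.Outcome) : Fin (k i) → Bool := s.1 i (s.2.1 i)

/-- The string not chosen by Bob-`i`. -/
def unchosenString (i : Fin 2) (s : π.Outcome) : Fin (k i) → Bool := s.1 i (!s.2.1 i)

/-- The estimate formed by Bob-`i`. -/
def estimateString (i : Fin 2) (s : π.Outcome) : Fin (k i) → Bool :=
  π.decode i (s.2.1 i) (s.2.2.2.1 i) (fun t => s.2.2.2.2 t i) (π.link i n s)

/-- Alice's final view without her private randomness. -/
def aliceView (s : π.Outcome) :
    OTStrings k × (Fin n → 𝒳) × (Fin 2 → ShortList π.msgCard π.maxLength) :=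
  (s.1, π.inputs s, fun i => truncate π.maxLength (π.link i n s))

/-- The final view of Bob-`i`. -/
def bobView (i : Fin 2) (s : π.Outcome) :
    Bool × π.RandB i × (Fin n → 𝒴 i) × ShortList π.msgCard π.maxLength :=
  (s.2.1 i, s.2.2.2.1 i, fun t => s.2.2.2.2 t i, truncate π.maxLength (π.link i n s))

theorem link_eq_of_truncate {i : Fin 2} {s t : π.Outcome}
    (e : truncate π.maxLength (π.link i n s) = truncate π.maxLength (π.link i n t)) :
    π.link i n s = π.link i n t :=
  truncate_inj (π.length_transcript_le _ _ _ _ _ _ le_rfl)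
    (π.length_transcript_le _ _ _ _ _ _ le_rfl) e

theorem det_bobView_bob (i : Fin 2) : Det (π.bobView i) (π.bob i n) := by
  intro s t e
  simp only [bobView, Prod.mk.injEq] at e
  simp only [bob, e.1, e.2.1, e.2.2.1]

theorem det_bobView_link (i : Fin 2) : Det (π.bobView i) (π.link i n) := by
  intro s t e
  simp only [bobView, Prod.mk.injEq] at e
  exact π.link_eq_of_truncate e.2.2.2

theorem det_estimateString (i : Fin 2) :
    Det (fun s => (π.bob i n s, π.link i n s)) (π.estimateString i) := by
  intro s t e
  simp only [bob, Prod.mk.injEq] at e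
  have h := det_of_take (fun s : π.Outcome => fun t => s.2.2.2.2 t i) s t e.1.2.2
  simp only at h
  simp only [estimateString, e.1.1, e.1.2.1, e.2, h]

theorem det_chosen (i : Fin 2) :
    Det (fun s => (π.alice s, s.2.1 i)) (π.chosenString i) := by
  intro s t e
  simp only [alice, Prod.mk.injEq] at e
  simp only [chosenString, e.1.1, e.2]

theorem det_bob_bit (i : Fin 2) (l : ℕ) : Det (π.bob i l) (fun s => s.2.1 i) :=
  fun s t e => by simp only [bob, Prod.mk.injEq] at e; exact e.1

theorem det_views_alice (i : Fin 2) :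
    Det (fun s => (π.inputs s, π.bobView 0 s, π.bobView 1 s))
      (fun s => ((π.aliceView s).2, s.2.1 i)) := by
  intro s t e
  simp only [Prod.mk.injEq] at e
  have a₀ := π.det_bobView_link 0 s t e.2.1
  have a₁ := π.det_bobView_link 1 s t e.2.2
  simp only [aliceView, Prod.mk.injEq]
  refine ⟨⟨e.1, funext fun j => congrArg (truncate _) ?_⟩,
    forall_fin_two_rev (P := fun i => s.2.1 i = t.2.1 i) 0 (congrArg Prod.fst e.2.1)
      (congrArg Prod.fst e.2.2) i⟩
  exact forall_fin_two_rev (P := fun j => π.link j n s = π.link j n t) 0 a₀ a₁ j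

variable [∀ i, Fintype (𝒴 i)] [Fintype π.RandA] [∀ i, Fintype (π.RandB i)]
variable {π} {W : 𝒳 → PMF (∀ i, 𝒴 i)} {q : π.Outcome → ℝ}

namespace IsRunLaw

theorem log_card_string (j : ℕ) :
    Real.log (Fintype.card (Fin j → Bool)) = j * Real.log 2 := by
  simp

theorem log_card_string_pair :
    Real.log (Fintype.card ((Fin (k 0) → Bool) × (Fin (k 1) → Bool))) =
      (k 0 + k 1 : ℝ) * Real.log 2 := by
  rw [Fintype.card_prod, Nat.cast_mul, Real.log_mul (by simp) (by simp), log_card_string,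
    log_card_string, add_mul]

/-- Strings and bits together have 2(k_1+k_2)+2 bits of entropy and are recovered from the unchosen
pair, the chosen pair and the bits. The last two account for at most k_1+k_2 and 2 bits. -/
theorem ent_unchosen_ge (hq : π.IsRunLaw W q) :
    (k 0 + k 1 : ℝ) * Real.log 2 ≤
      ent q (fun s => (π.unchosenString 0 s, π.unchosenString 1 s)) := by
  have h₁ := ent_of_mass_eq hq.sum_eq_one _ _ hq.uniform
  have h₂ : Real.log (Fintype.card (OTStrings k)) = 2 * ((k 0 + k 1 : ℝ) * Real.log 2) := by
    simp only [OTStrings, Fintype.card_pi, Fin.prod_univ_two, Fintype.prod_bool, Nat.cast_mul]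
    rw [Real.log_mul (by simp) (by simp), Real.log_mul (by simp) (by simp),
      Real.log_mul (by simp) (by simp)]
    simp
    ring
  rw [Fintype.card_prod, Nat.cast_mul, Real.log_inv, neg_neg,
    Real.log_mul (by simp) (by simp), h₂] at h₁
  have h₃ := ent_le_card hq.nonneg hq.sum_eq_one (fun s : π.Outcome => s.2.1)
  have h₄ := ent_le_card hq.nonneg hq.sum_eq_one
    (fun s => (π.chosenString 0 s, π.chosenString 1 s))
  rw [log_card_string_pair] at h₄
  have h₅ : ent q (fun s => (s.1, s.2.1)) ≤
      ent q (fun s => ((π.unchosenString 0 s, π.unchosenString 1 s),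
        (π.chosenString 0 s, π.chosenString 1 s), s.2.1)) := by
    refine ent_mono hq.nonneg fun s t e => ?_
    simp only [Prod.mk.injEq, unchosenString, chosenString] at e ⊢
    obtain ⟨⟨a₀, a₁⟩, ⟨b₀, b₁⟩, hz⟩ := e
    rw [hz] at a₀ a₁ b₀ b₁
    refine ⟨funext (Fin.forall_fin_two.2 ⟨?_, ?_⟩), hz⟩
    · funext b
      rcases Bool.eq_or_eq_not b (t.2.1 0) with h | h <;> rw [h] <;> assumption
    · funext b
      rcases Bool.eq_or_eq_not b (t.2.1 1) with h | h <;> rw [h] <;> assumption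
  have h₆ := ent_submod hq.nonneg (q := q)
    (f := fun s => (π.unchosenString 0 s, π.unchosenString 1 s))
    (g := fun s => ((π.chosenString 0 s, π.chosenString 1 s), s.2.1))
    (j := fun s => ((π.unchosenString 0 s, π.unchosenString 1 s),
        (π.chosenString 0 s, π.chosenString 1 s), s.2.1)) (m := fun _ => ())
    (fun _ _ _ => rfl) (fun _ _ _ => rfl) (fun _ _ e => e)
  have h₇ := ent_submod hq.nonneg (q := q)
    (f := fun s => (π.chosenString 0 s, π.chosenString 1 s)) (g := fun s => s.2.1)
    (j := fun s => ((π.chosenString 0 s, π.chosenString 1 s), s.2.1)) (m := fun _ => ())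
    (fun _ _ _ => rfl) (fun _ _ _ => rfl) (fun _ _ e => e)
  rw [ent_const hq.sum_eq_one] at h₆ h₇
  linarith

theorem mass_not_bits (hq : π.IsRunLaw W q) (z : Fin 2 → Bool) :
    mass q (fun s => s.2.1) (flipBits z) =
      mass q (fun s => s.2.1) z := by
  have h := mass_comp q (fun s => (s.1, s.2.1)) (T := OTStrings k × (Fin 2 → Bool)) Prod.snd
  rw [← h, ← h, funext hq.uniform]
  exact mass_const_perm _ Prod.snd (Equiv.prodCongr (Equiv.refl (OTStrings k)) flipBits) flipBits
    (fun _ => rfl) z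

theorem mass_not_bit (hq : π.IsRunLaw W q) (i : Fin 2) (b : Bool) :
    mass q (fun s => s.2.1 i) (Equiv.boolNot b) = mass q (fun s => s.2.1 i) b := by
  have h := mass_comp q (fun s => (s.1, s.2.1)) (T := OTStrings k × (Fin 2 → Bool))
    fun p => p.2 i
  rw [← h, ← h, funext hq.uniform]
  exact mass_const_perm _ (fun p : OTStrings k × (Fin 2 → Bool) => p.2 i)
    (Equiv.prodCongr (Equiv.refl (OTStrings k)) flipBits) Equiv.boolNot (fun _ => rfl) b

/-- The l-th input of the run, with its actual law, is a competitor in every single-letter maximum.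
-/
theorem channelJoint_eq_mass (hq : π.IsRunLaw W q) (l : Fin n) :
    channelJoint W (mass q fun s => π.inputs s l) =
      mass q fun s => (π.inputs s l, π.outputs s l) := by
  funext p
  rw [channelJoint, ← hq.channel_input]

/-! ### Comparison of one channel use with the single-letter maxima. -/

variable [Fintype 𝒳]

theorem shannonH_channelJoint (hq : π.IsRunLaw W q) (l : Fin n) {β : Type*} [Fintype β]
    (f : 𝒳 × (∀ i, 𝒴 i) → β) :
    shannonH (channelJoint W (mass q fun s => π.inputs s l)) f =
      ent q (fun s => f (π.inputs s l, π.outputs s l)) / Real.log 2 := by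
  rw [hq.channelJoint_eq_mass, shannonH_eq_ent, ent_mass]

theorem le_maxOverInputs (hq : π.IsRunLaw W q) (l : Fin n) {F : (𝒳 → ℝ) → ℝ}
    (hF : Continuous F) : F (mass q fun s => π.inputs s l) ≤ maxOverInputs F := by
  have : Nonempty π.Outcome := by
    by_contra h
    rw [not_nonempty_iff] at h
    simpa using hq.sum_eq_one
  have : Nonempty 𝒳 := ⟨π.inputs (Classical.arbitrary π.Outcome) l⟩
  refine (isGreatest_maxOverInputs hF).2 ⟨_, ⟨mass_nonneg hq.nonneg _, ?_⟩, rfl⟩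
  rw [sum_mass, hq.sum_eq_one]

theorem info_le_maxI (hq : π.IsRunLaw W q) (i : Fin 2) (l : Fin n) :
    ent q (fun s => π.outputs s l i) -
      condEnt q (fun s => π.outputs s l i) (fun s => π.inputs s l) ≤ maxI W i * Real.log 2 := by
  have h := hq.le_maxOverInputs l (F := fun p => shannonI (channelJoint W p) (fun s => s.1)
    (fun s => s.2 i)) (by
      unfold shannonI shannonCondH
      have := continuous_shannonH_channelJoint W (fun s => s.1)
      have := continuous_shannonH_channelJoint W (fun s => (s.1, s.2 i))
      have := continuous_shannonH_channelJoint W (fun s => s.2 i)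
      fun_prop)
  have e : ent q (fun s => (π.outputs s l i, π.inputs s l)) =
      ent q (fun s => (π.inputs s l, π.outputs s l i)) :=
    ent_congr q (fun s t e => by simp_all) (fun s t e => by simp_all)
  simp only [shannonI, shannonCondH, hq.shannonH_channelJoint] at h
  rw [← sub_div, ← sub_div, div_le_iff₀ (Real.log_pos one_lt_two)] at h
  refine le_trans (le_of_eq ?_) h
  rw [condEnt, e]
  ring

theorem info_le_maxCondI (hq : π.IsRunLaw W q) (i : Fin 2) (l : Fin n) :
    condEnt q (fun s => π.outputs s l i) (fun s => π.outputs s l i.rev) -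
      condEnt q (fun s => π.outputs s l i) (fun s => (π.inputs s l, π.outputs s l i.rev)) ≤
      maxCondI W i * Real.log 2 := by
  have h := hq.le_maxOverInputs l (F := fun p => shannonCondI (channelJoint W p) (fun s => s.1)
    (fun s => s.2 i) (fun s => s.2 i.rev)) (by
      unfold shannonCondI shannonCondH
      have := continuous_shannonH_channelJoint W (fun s => (s.1, s.2 i.rev))
      have := continuous_shannonH_channelJoint W (fun s => s.2 i.rev)
      have := continuous_shannonH_channelJoint W (fun s => (s.1, s.2 i, s.2 i.rev))
      have := continuous_shannonH_channelJoint W (fun s => (s.2 i, s.2 i.rev))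
      fun_prop)
  have e : ent q (fun s => (π.outputs s l i, π.inputs s l, π.outputs s l i.rev)) =
      ent q (fun s => (π.inputs s l, π.outputs s l i, π.outputs s l i.rev)) :=
    ent_congr q (fun s t e => by simp_all) (fun s t e => by simp_all)
  simp only [shannonCondI, shannonCondH, hq.shannonH_channelJoint] at h
  rw [← sub_div, ← sub_div, ← sub_div, div_le_iff₀ (Real.log_pos one_lt_two)] at h
  refine le_trans (le_of_eq ?_) h
  rw [condEnt, condEnt, e]
  ring

theorem info_le_maxJointI (hq : π.IsRunLaw W q) (l : Fin n) :
    ent q (fun s => π.outputs s l) -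
      condEnt q (fun s => π.outputs s l) (fun s => π.inputs s l) ≤ maxJointI W * Real.log 2 := by
  have h := hq.le_maxOverInputs l (F := fun p => shannonI (channelJoint W p) (fun s => s.1)
    (fun s => s.2)) (by
      unfold shannonI shannonCondH
      have := continuous_shannonH_channelJoint W (fun s => s.1)
      have := continuous_shannonH_channelJoint W (fun s => (s.1, s.2))
      have := continuous_shannonH_channelJoint W (fun s => s.2)
      fun_prop)
  have e : ent q (fun s => (π.outputs s l, π.inputs s l)) =
      ent q (fun s => (π.inputs s l, π.outputs s l)) :=
    ent_congr q (fun s t e => by simp_all) (fun s t e => by simp_all)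
  simp only [shannonI, shannonCondH, hq.shannonH_channelJoint] at h
  rw [← sub_div, ← sub_div, div_le_iff₀ (Real.log_pos one_lt_two)] at h
  refine le_trans (le_of_eq ?_) h
  rw [condEnt, e]
  ring

theorem equivocation_le_maxEquivocation (hq : π.IsRunLaw W q) (l : Fin n) :
    condEnt q (fun s => π.inputs s l) (fun s => π.outputs s l) ≤
      maxEquivocation W * Real.log 2 := by
  have h := hq.le_maxOverInputs l (F := fun p => shannonCondH (channelJoint W p) (fun s => s.1)
    (fun s => s.2)) (by
      unfold shannonCondH
      have := continuous_shannonH_channelJoint W (fun s => (s.1, s.2))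
      have := continuous_shannonH_channelJoint W (fun s => s.2)
      fun_prop)
  simp only [shannonCondH, hq.shannonH_channelJoint] at h
  rw [← sub_div, div_le_iff₀ (Real.log_pos one_lt_two)] at h
  exact h

end IsRunLaw

end OTProtocol

/-! ### Bounds on the lengths of the strings -/

namespace OTProtocol

variable {𝒳 : Type*} {𝒴 : Fin 2 → Type*} [MeasurableSpace 𝒳] {n : ℕ} {k : Fin 2 → ℕ}
variable {π : OTProtocol 𝒳 𝒴 n k}
variable [Fintype 𝒳] [∀ i, Fintype (𝒴 i)] [Fintype π.RandA] [∀ i, Fintype (π.RandB i)]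
variable {W : 𝒳 → PMF (∀ i, 𝒴 i)} {q : π.Outcome → ℝ}

/-- The law `q` of a run is `ε`-correct, and `ε`-secure with respect to the `ℓ¹` distance. -/
structure IsSecure (q : π.Outcome → ℝ) (ε : ℝ) : Prop where
  error_le : ∀ i, ∑ s, {s | π.estimateString i s ≠ π.chosenString i s}.indicator q s ≤ ε
  unchosen_le : dependence q (fun s => (π.unchosenString 0 s, π.unchosenString 1 s))
    (fun s => (π.bobView 0 s, π.bobView 1 s)) ≤ ε
  bit_le : ∀ i : Fin 2, dependence q (fun s => s.2.1 i)
    (fun s => (π.aliceView s, π.bobView i.rev s)) ≤ ε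
  bits_le : dependence q (fun s => s.2.1) π.aliceView ≤ ε

theorem sum_lengths_rev (i : Fin 2) : (k 0 + k 1 : ℝ) = k i + k i.rev := by
  fin_cases i
  · rfl
  · exact add_comm _ _

namespace IsRunLaw

/-- Correctness through Fano's inequality: Bob-i's data and his transcript determine his estimate.
-/
theorem condEnt_chosen_le (hq : π.IsRunLaw W q) {ε : ℝ} (hs : IsSecure q ε) {β : Type*}
    (i : Fin 2) {g : π.Outcome → β} (h₁ : Det g (π.bob i n)) (h₂ : Det g (π.link i n)) :
    condEnt q (π.chosenString i) g ≤ Real.log 2 + ε * (k i * Real.log 2) := by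
  have h := condEnt_le_of_error_le hq.nonneg hq.sum_eq_one (π.chosenString i) g
    (π.estimateString i) ((h₁.pair h₂).trans (π.det_estimateString i)) (hs.error_le i)
  rwa [log_card_string] at h

theorem condEnt_unchosen_pair_ge (hq : π.IsRunLaw W q) {ε : ℝ} (hs : IsSecure q ε) :
    (k 0 + k 1) * Real.log 2 - ε * ((k 0 + k 1) * Real.log 2) - Real.log 2 ≤
      condEnt q (fun s => (π.unchosenString 0 s, π.unchosenString 1 s))
        (fun s => (π.bobView 0 s, π.bobView 1 s)) := by
  have h₁ := hq.ent_unchosen_ge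
  have h₂ := ent_le_condEnt_of_dependence_le hq.nonneg hq.sum_eq_one _ _ hs.unchosen_le
  rw [log_card_string_pair] at h₂
  linarith

/-- Remove from the joint equivocation of the two unchosen strings the at most k_j bits, j the other
index, contributed by the other one. -/
theorem condEnt_unchosen_ge (hq : π.IsRunLaw W q) {ε : ℝ} (hs : IsSecure q ε) (i : Fin 2) :
    k i * Real.log 2 - ε * ((k 0 + k 1) * Real.log 2) - Real.log 2 ≤
      condEnt q (π.unchosenString i) (fun s => (π.bobView i s, π.bobView i.rev s)) := by
  have h := hq.condEnt_unchosen_pair_ge hs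
  have h₁ : condEnt q (fun s => (π.unchosenString 0 s, π.unchosenString 1 s))
      (fun s => (π.bobView 0 s, π.bobView 1 s)) =
      condEnt q (fun s => (π.unchosenString i s, π.unchosenString i.rev s))
        (fun s => (π.bobView i s, π.bobView i.rev s)) := by
    fin_cases i
    · rfl
    · refine le_antisymm ?_ ?_
      · refine (condEnt_mono hq.nonneg _ fun s t e => ?_).trans
          (condEnt_anti hq.nonneg _ fun s t e => ?_) <;> simp_all
      · refine (condEnt_mono hq.nonneg _ fun s t e => ?_).trans
          (condEnt_anti hq.nonneg _ fun s t e => ?_) <;> simp_all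
  have h₂ := condEnt_le_card hq.nonneg (π.unchosenString i.rev)
    (fun s => (π.unchosenString i s, π.bobView i s, π.bobView i.rev s))
  rw [hq.sum_eq_one, one_mul, log_card_string] at h₂
  have e : ent q (fun s => (π.unchosenString i.rev s, π.unchosenString i s, π.bobView i s,
      π.bobView i.rev s)) = ent q (fun s => ((π.unchosenString i s, π.unchosenString i.rev s),
      π.bobView i s, π.bobView i.rev s)) :=
    ent_congr q (fun s t e => by simp_all) (fun s t e => by simp_all)
  rw [h₁] at h
  rw [sum_lengths_rev i] at h ⊢
  unfold condEnt at *
  linarith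

/-- The obliviousness step. Negating the nearly independent, uniform bit exchanges the two strings
of Bob-i while the observer's data `g` stay fixed, so what hides or reveals one string does the same
for the other. -/
theorem condEnt_swap_le (hq : π.IsRunLaw W q) {ε : ℝ} (hs : IsSecure q ε) (i : Fin 2) {δ : Type*}
    (g : (OTStrings k × (Fin n → 𝒳) × (Fin 2 → ShortList π.msgCard π.maxLength)) ×
      (Bool × π.RandB i.rev × (Fin n → 𝒴 i.rev) × ShortList π.msgCard π.maxLength) → δ) :
    condEnt q (π.unchosenString i) (fun s => (g (π.aliceView s, π.bobView i.rev s), s.2.1 i)) ≤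
      condEnt q (π.chosenString i) (fun s => (g (π.aliceView s, π.bobView i.rev s), s.2.1 i))
        + 2 * ε * (k i * Real.log 2) + Real.log 2 := by
  have h := condEnt_le_condEnt_perm hq.nonneg hq.sum_eq_one (fun s => s.2.1 i)
    (fun s => (π.aliceView s, π.bobView i.rev s)) Equiv.boolNot (hq.mass_not_bit i)
    (hs.bit_le i) (fun b j => j.1.1 i (!b)) g
  rw [log_card_string] at h
  refine h.trans_eq ?_
  congr 3
  funext s
  simp [aliceView, chosenString]

/-- The string chosen by Bob-`i` is almost unknown to an observer of his link who colludes with the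
other Bob. -/
theorem condEnt_chosen_ge (hq : π.IsRunLaw W q) {ε : ℝ} (hs : IsSecure q ε) (i : Fin 2) :
    k i * Real.log 2 - ε * ((k 0 + k 1) * Real.log 2) - 2 * ε * (k i * Real.log 2)
        - 2 * Real.log 2 ≤
      condEnt q (π.chosenString i)
        (fun s => (s.2.1 i, π.link i n s, π.link i.rev n s, π.bob i.rev n s)) := by
  have h₁ := hq.condEnt_unchosen_ge hs i
  have h₂ := hq.condEnt_swap_le hs i fun j => (j.1.2.2, j.2)
  have h₃ : condEnt q (π.unchosenString i) (fun s => (π.bobView i s, π.bobView i.rev s)) ≤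
      condEnt q (π.unchosenString i)
        (fun s => (((π.aliceView s).2.2, π.bobView i.rev s), s.2.1 i)) := by
    refine condEnt_anti hq.nonneg _ fun s t e => ?_
    simp only [Prod.mk.injEq] at e ⊢
    refine ⟨⟨funext fun j => congrArg (truncate _) ?_, e.2⟩, congrArg Prod.fst e.1⟩
    exact forall_fin_two_rev (P := fun j => π.link j n s = π.link j n t) i
      (π.det_bobView_link i s t e.1) (π.det_bobView_link i.rev s t e.2) j
  have h₄ : condEnt q (π.chosenString i)
      (fun s => (((π.aliceView s).2.2, π.bobView i.rev s), s.2.1 i)) ≤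
      condEnt q (π.chosenString i)
        (fun s => (s.2.1 i, π.link i n s, π.link i.rev n s, π.bob i.rev n s)) := by
    refine condEnt_anti hq.nonneg _ fun s t e => ?_
    simp only [Prod.mk.injEq] at e ⊢
    exact ⟨e.2, π.link_eq_of_truncate (congrFun e.1.1 i),
      π.link_eq_of_truncate (congrFun e.1.1 i.rev), π.det_bobView_bob i.rev s t e.1.2⟩
  simp only at h₂
  linarith

theorem length_le_maxI (hq : π.IsRunLaw W q) {ε : ℝ} (hε : 0 ≤ ε) (hs : IsSecure q ε) (i : Fin 2) :
    (k i : ℝ) ≤ n * maxI W i + 4 * ε * (k 0 + k 1) + 5 := by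
  have h₁ := hq.condEnt_chosen_ge hs i
  -- For this bound the observer forgets the other Bob and the other link, so that the channel gain
  -- becomes the unconditional I(X;Y_i).
  have h₂ : condEnt q (π.chosenString i)
      (fun s => (s.2.1 i, π.link i n s, π.link i.rev n s, π.bob i.rev n s)) ≤
      condEnt q (π.chosenString i) (fun s => (s.2.1 i, π.link i n s)) :=
    condEnt_anti hq.nonneg _ fun s t e => by simp_all
  have h₃ := condEnt_le_condEnt_add_condMI hq.nonneg (h := π.link i n) (π.det_bob_bit i n)
    (π.det_chosen i)
  have h₄ := hq.condEnt_chosen_le hs i (g := fun s => (π.bob i n s, π.link i n s))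
    (Det.comp Prod.fst) (Det.comp Prod.snd)
  have h₅ := hq.condMI_link_bound i (hq.info_le_maxI i) le_rfl
  have hl := Real.log_pos one_lt_two
  have h₆ : 0 ≤ ε * (k i.rev * Real.log 2) := by positivity
  rw [sum_lengths_rev i] at h₁ ⊢
  refine le_of_mul_le_mul_right ?_ hl
  linarith

theorem length_le_maxCondI (hq : π.IsRunLaw W q) {ε : ℝ} (hε : 0 ≤ ε) (hs : IsSecure q ε)
    (i : Fin 2) : (k i : ℝ) ≤ n * maxCondI W i + 4 * ε * (k 0 + k 1) + 5 := by
  have h₁ := hq.condEnt_chosen_ge hs i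
  have h₃ := condEnt_le_condEnt_add_condMI hq.nonneg
    (h := fun s => (π.link i n s, π.link i.rev n s, π.bob i.rev n s)) (π.det_bob_bit i n)
    (π.det_chosen i)
  have h₄ := hq.condEnt_chosen_le hs i
    (g := fun s => (π.bob i n s, π.link i n s, π.link i.rev n s, π.bob i.rev n s))
    (Det.comp Prod.fst) (fun s t e => by simp_all)
  have h₅ := hq.condMI_bob_bound i (hq.info_le_maxCondI i) le_rfl
  have hl := Real.log_pos one_lt_two
  have h₆ : 0 ≤ ε * (k i.rev * Real.log 2) := by positivity
  rw [sum_lengths_rev i] at h₁ ⊢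
  refine le_of_mul_le_mul_right ?_ hl
  linarith

/-- The two Bobs act as one receiver, and the pair of chosen strings is the key, secret from an
observer of both transcripts who also knows both bits. Both bits must be negated at once, which is
what `bits_le` permits. -/
theorem sum_lengths_le_maxJointI (hq : π.IsRunLaw W q) {ε : ℝ} (hs : IsSecure q ε) :
    (k 0 + k 1 : ℝ) ≤ n * maxJointI W + 4 * ε * (k 0 + k 1) + 5 := by
  have h₁ := hq.condEnt_unchosen_pair_ge hs
  have h₂ : condEnt q (fun s => (π.unchosenString 0 s, π.unchosenString 1 s))
      (fun s => ((π.aliceView s).2.2, s.2.1)) ≤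
      condEnt q (fun s => (π.chosenString 0 s, π.chosenString 1 s))
        (fun s => ((π.aliceView s).2.2, s.2.1))
        + 2 * ε * ((k 0 + k 1) * Real.log 2) + Real.log 2 := by
    have h := condEnt_le_condEnt_perm hq.nonneg hq.sum_eq_one (fun s => s.2.1)
      π.aliceView flipBits hq.mass_not_bits
      hs.bits_le (fun b j => (j.1 0 (!b 0), j.1 1 (!b 1))) fun j => j.2.2
    rw [log_card_string_pair] at h
    refine h.trans_eq ?_
    congr 3
    funext s
    simp [aliceView, chosenString, flipBits]
  have h₃ : condEnt q (fun s => (π.unchosenString 0 s, π.unchosenString 1 s))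
      (fun s => (π.bobView 0 s, π.bobView 1 s)) ≤
      condEnt q (fun s => (π.unchosenString 0 s, π.unchosenString 1 s))
        (fun s => ((π.aliceView s).2.2, s.2.1)) := by
    refine condEnt_anti hq.nonneg _ fun s t e => ?_
    simp only [Prod.mk.injEq] at e ⊢
    have a₀ := π.det_bobView_link 0 s t e.1
    have a₁ := π.det_bobView_link 1 s t e.2
    refine ⟨funext fun j => congrArg (truncate _) ?_, funext (Fin.forall_fin_two.2
      ⟨congrArg Prod.fst e.1, congrArg Prod.fst e.2⟩)⟩
    exact forall_fin_two_rev (P := fun j => π.link j n s = π.link j n t) 0 a₀ a₁ j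
  have h₄ : condEnt q (fun s => (π.chosenString 0 s, π.chosenString 1 s))
      (fun s => ((π.aliceView s).2.2, s.2.1)) ≤
      condEnt q (fun s => (π.chosenString 0 s, π.chosenString 1 s))
        (fun s => (s.2.1, π.link 0 n s, π.link 1 n s)) := by
    refine condEnt_anti hq.nonneg _ fun s t e => ?_
    simp only [Prod.mk.injEq] at e ⊢
    exact ⟨e.2, π.link_eq_of_truncate (congrFun e.1 0), π.link_eq_of_truncate (congrFun e.1 1)⟩
  have h₅ := condEnt_le_condEnt_add_condMI hq.nonneg (f := π.alice)
    (g := fun s => (π.bob 0 n s, π.bob 1 n s)) (h := fun s => (π.link 0 n s, π.link 1 n s))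
    (z := fun s => s.2.1) (k := fun s => (π.chosenString 0 s, π.chosenString 1 s))
    (fun s t e => by
      simp only [Prod.mk.injEq] at e
      exact funext (Fin.forall_fin_two.2 ⟨π.det_bob_bit 0 n s t e.1, π.det_bob_bit 1 n s t e.2⟩))
    (fun s t e => by
      simp only [alice, Prod.mk.injEq] at e
      simp only [chosenString, e.1.1, e.2])
  have h₆ := hq.condEnt_chosen_le hs 0
    (g := fun s => ((π.bob 0 n s, π.bob 1 n s), π.link 0 n s, π.link 1 n s))
    (fun s t e => by simp_all) (fun s t e => by simp_all)
  have h₇ := hq.condEnt_chosen_le hs 1 (g := fun s => (π.chosenString 0 s,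
    (π.bob 0 n s, π.bob 1 n s), π.link 0 n s, π.link 1 n s))
    (fun s t e => by simp_all) (fun s t e => by simp_all)
  have h₈ := hq.condMI_bobs_bound hq.info_le_maxJointI le_rfl
  have e : ent q (fun s => ((π.chosenString 0 s, π.chosenString 1 s),
      (π.bob 0 n s, π.bob 1 n s), π.link 0 n s, π.link 1 n s)) =
      ent q (fun s => (π.chosenString 1 s, π.chosenString 0 s,
      (π.bob 0 n s, π.bob 1 n s), π.link 0 n s, π.link 1 n s)) :=
    ent_congr q (fun s t e => by simp_all) (fun s t e => by simp_all)
  have hl := Real.log_pos one_lt_two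
  refine le_of_mul_le_mul_right ?_ hl
  have h₉ := h₁.trans (h₃.trans (h₂.trans (add_le_add_left (add_le_add_left
    (h₄.trans h₅) _) _)))
  clear h₁ h₂ h₃ h₄ h₅
  unfold condEnt at h₆ h₇ h₉
  linarith

/-- Given inputs, transcripts and `Z_i`, the Bobs' further data say nothing more about Alice, so the
chosen string is nearly determined already, and by the exchange so is the unchosen one. Knowledge of
X^n would thus break the secrecy of both unchosen strings. The loss of 1 bit for secrecy and 2 for
each string makes up the constant 5, which the other bounds share with room to spare. -/
theorem sum_lengths_le_maxEquivocation (hq : π.IsRunLaw W q) {ε : ℝ} (hs : IsSecure q ε) :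
    (k 0 + k 1 : ℝ) ≤ n * maxEquivocation W + 4 * ε * (k 0 + k 1) + 5 := by
  have h₁ := hq.condEnt_unchosen_pair_ge hs
  have hl := Real.log_pos one_lt_two
  have unchosen : ∀ i, condEnt q (π.unchosenString i)
      (fun s => ((π.aliceView s).2, s.2.1 i)) ≤ 3 * ε * (k i * Real.log 2) + 2 * Real.log 2 := by
    intro i
    have a₁ := hq.condEnt_swap_le hs i fun j => j.1.2
    have a₂ : condEnt q (π.chosenString i) (fun s => ((π.aliceView s).2, s.2.1 i)) ≤
        condEnt q (π.chosenString i) (fun s => (s.2.1 i, π.link 0 n s, π.link 1 n s,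
          (List.ofFn (π.inputs s)).take n)) := by
      refine condEnt_anti hq.nonneg _ fun s t e => ?_
      simp only [Prod.mk.injEq, aliceView] at e ⊢
      exact ⟨e.2, π.link_eq_of_truncate (congrFun e.1.2 0),
        π.link_eq_of_truncate (congrFun e.1.2 1), by rw [e.1.1]⟩
    have a₃ := condEnt_le_condEnt_add_condMI hq.nonneg (f := π.alice)
      (g := fun s => (π.bob 0 n s, π.bob 1 n s)) (h := fun s => (π.link 0 n s, π.link 1 n s,
          (List.ofFn (π.inputs s)).take n))
      (z := fun s => s.2.1 i) (k := π.chosenString i)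
      (fun s t e => by
        simp only [Prod.mk.injEq] at e
        exact forall_fin_two_rev (P := fun i => s.2.1 i = t.2.1 i) 0
          (π.det_bob_bit 0 n s t e.1) (π.det_bob_bit 1 n s t e.2) i)
      (π.det_chosen i)
    have a₄ := hq.condEnt_chosen_le hs i (g := fun s => ((π.bob 0 n s, π.bob 1 n s),
        π.link 0 n s, π.link 1 n s, (List.ofFn (π.inputs s)).take n))
      (by fin_cases i <;> exact fun s t e => by simp_all)
      (by fin_cases i <;> exact fun s t e => by simp_all)
    have a₅ := hq.condMI_inputs_le_zero le_rfl
    simp only at a₁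
    linarith
  have h₃ := (condEnt_anti hq.nonneg (π.unchosenString 0) (π.det_views_alice 0)).trans (unchosen 0)
  have h₄ := (condEnt_anti hq.nonneg (π.unchosenString 1)
    (g := fun s => (π.unchosenString 0 s, π.inputs s, π.bobView 0 s, π.bobView 1 s))
    ((Det.comp Prod.snd).trans (π.det_views_alice 1))).trans (unchosen 1)
  have h₅ := condEnt_prefix_le hq.nonneg hq.sum_eq_one π.inputs π.outputs
    hq.equivocation_le_maxEquivocation
  have h₆ : condEnt q π.inputs (fun s => (π.bobView 0 s, π.bobView 1 s)) ≤
      condEnt q π.inputs π.outputs := by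
    refine condEnt_anti hq.nonneg _ fun s t e => ?_
    simp only [bobView, Prod.mk.injEq] at e
    exact funext fun l => funext (Fin.forall_fin_two.2
      ⟨congrFun e.1.2.2.1 l, congrFun e.2.2.2.1 l⟩)
  have h₇ : ent q (fun s => ((π.unchosenString 0 s, π.unchosenString 1 s), π.bobView 0 s,
      π.bobView 1 s)) ≤ ent q (fun s => (π.unchosenString 1 s, π.unchosenString 0 s, π.inputs s,
      π.bobView 0 s, π.bobView 1 s)) :=
    ent_mono hq.nonneg fun s t e => by simp_all
  refine le_of_mul_le_mul_right ?_ hl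
  have h₈ := h₆.trans h₅
  clear h₅ h₆ unchosen
  unfold condEnt at h₁ h₃ h₄ h₈
  linarith

end IsRunLaw

end OTProtocol

/-! ### From divergence to total variation -/

namespace FiniteEntropy

/-- Pointwise domination of squared Hellinger distance by divergence, from log √x ≥ 1 - 1/√x. -/
theorem sq_sqrt_sub_one_le_klFun {x : ℝ} (hx : 0 ≤ x) :
    (√x - 1) ^ 2 ≤ InformationTheory.klFun x := by
  rw [InformationTheory.klFun_apply]
  rcases hx.eq_or_lt with h | h
  · simp [← h]
  · have h₁ : 0 < √x := Real.sqrt_pos.2 h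
    have h₂ := Real.one_sub_inv_le_log_of_pos h₁
    rw [Real.log_sqrt hx] at h₂
    have h₃ : √x ^ 2 = x := Real.sq_sqrt hx
    have h₄ : x * (1 - (√x)⁻¹) = x - √x := by
      rw [mul_sub, mul_one]
      congr 1
      rw [← div_eq_mul_inv, Real.div_sqrt]
    nlinarith [mul_le_mul_of_nonneg_left h₂ hx]

/-- Factor |x - 1| = |√x - 1|(√x + 1) and apply the weighted arithmetic-geometric mean inequality.
Integrated against a divergence of at most t², both terms are of order t. -/
theorem abs_sub_one_le_klFun {x t : ℝ} (hx : 0 ≤ x) (ht : 0 < t) :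
    |x - 1| ≤ InformationTheory.klFun x / (2 * t) + t * (x + 1) := by
  have h₁ := sq_sqrt_sub_one_le_klFun hx
  have h₂ : √x ^ 2 = x := Real.sq_sqrt hx
  have h₃ : |x - 1| = |√x - 1| * (√x + 1) := by
    rw [← abs_of_nonneg (add_nonneg (Real.sqrt_nonneg x) zero_le_one), ← abs_mul]
    congr 1
    nlinarith
  have h₄ : |√x - 1| * (√x + 1) ≤ (√x - 1) ^ 2 / (2 * t) + t / 2 * (√x + 1) ^ 2 := by
    rw [← sq_abs (√x - 1), div_add' _ _ _ (by positivity), le_div_iff₀ (by positivity)]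
    nlinarith [sq_nonneg (|√x - 1| - t * (√x + 1))]
  have h₅ : (√x - 1) ^ 2 / (2 * t) ≤ InformationTheory.klFun x / (2 * t) := by gcongr
  have h₆ : (√x + 1) ^ 2 ≤ 2 * (x + 1) := by nlinarith [sq_nonneg (√x - 1)]
  nlinarith

theorem sum_abs_measure_sub_le_of_klDiv_le {α ι : Type*} [MeasurableSpace α] [Fintype ι]
    {μ ν : Measure α} [IsProbabilityMeasure μ] [IsProbabilityMeasure ν] {t : ℝ} (ht : 0 < t)
    (h : InformationTheory.klDiv μ ν ≤ ENNReal.ofReal (t ^ 2)) {E : ι → Set α}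
    (hE : ∀ j, MeasurableSet (E j)) (hd : Pairwise fun i j => Disjoint (E i) (E j)) :
    ∑ j, |μ.real (E j) - ν.real (E j)| ≤ 3 * t := by
  obtain ⟨hac, hint⟩ := InformationTheory.klDiv_ne_top_iff.1
    (h.trans_lt ENNReal.ofReal_lt_top).ne
  have hk : Integrable (fun x => InformationTheory.klFun (μ.rnDeriv ν x).toReal) ν :=
    (InformationTheory.integrable_klFun_rnDeriv_iff hac).2 hint
  have hr : Integrable (fun x => (μ.rnDeriv ν x).toReal) ν := Measure.integrable_toReal_rnDeriv
  have hr₁ : Integrable (fun x => (μ.rnDeriv ν x).toReal - 1) ν := hr.sub (integrable_const 1)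
  have hr₂ : Integrable (fun x => t * ((μ.rnDeriv ν x).toReal + 1)) ν :=
    (hr.add (integrable_const 1)).const_mul t
  have hkl : ∫ x, InformationTheory.klFun (μ.rnDeriv ν x).toReal ∂ν ≤ t ^ 2 := by
    rw [← InformationTheory.toReal_klDiv_eq_integral_klFun hac]
    exact ENNReal.toReal_le_of_le_ofReal (by positivity) h
  have hset : ∀ j, |μ.real (E j) - ν.real (E j)| ≤
      ∫ x in E j, |(μ.rnDeriv ν x).toReal - 1| ∂ν := by
    intro j
    have : μ.real (E j) - ν.real (E j) = ∫ x in E j, ((μ.rnDeriv ν x).toReal - 1) ∂ν := by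
      rw [integral_sub hr.integrableOn (integrable_const 1),
        Measure.setIntegral_toReal_rnDeriv hac]
      simp
    rw [this]
    exact abs_integral_le_integral_abs
  calc _ ≤ ∑ j, ∫ x in E j, |(μ.rnDeriv ν x).toReal - 1| ∂ν := Finset.sum_le_sum fun j _ => hset j
    _ = ∫ x in ⋃ j, E j, |(μ.rnDeriv ν x).toReal - 1| ∂ν :=
        (integral_iUnion_fintype hE hd fun j => hr₁.abs.integrableOn).symm
    _ ≤ ∫ x, |(μ.rnDeriv ν x).toReal - 1| ∂ν :=
        setIntegral_le_integral hr₁.abs (ae_of_all _ fun _ => abs_nonneg _)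
    _ ≤ ∫ x, (InformationTheory.klFun (μ.rnDeriv ν x).toReal / (2 * t) +
          t * ((μ.rnDeriv ν x).toReal + 1)) ∂ν := by
        refine integral_mono hr₁.abs ((hk.div_const _).add hr₂) fun x => ?_
        exact abs_sub_one_le_klFun ENNReal.toReal_nonneg ht
    _ = (∫ x, InformationTheory.klFun (μ.rnDeriv ν x).toReal ∂ν) / (2 * t) + t * 2 := by
        rw [integral_add (hk.div_const _) hr₂,
          integral_div, integral_const_mul, integral_add hr (integrable_const 1),
          Measure.integral_toReal_rnDeriv hac]
        simp
        norm_num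
    _ ≤ t ^ 2 / (2 * t) + t * 2 := by gcongr
    _ ≤ 3 * t := by
        rw [pow_two, mul_div_mul_right _ _ ht.ne']
        linarith

variable {Ω S α β γ δ : Type*} [MeasurableSpace Ω] [Fintype S] {P : Measure Ω}
  [IsProbabilityMeasure P] {Φ : Ω → S}

theorem sum_indicator_law (hΦ : ∀ s, MeasurableSet (Φ ⁻¹' {s})) (E : Set S) :
    ∑ s, E.indicator (fun s => P.real (Φ ⁻¹' {s})) s = P.real {ω | Φ ω ∈ E} := by
  classical
  have h : {ω | Φ ω ∈ E} = ⋃ s ∈ Finset.univ.filter (· ∈ E), Φ ⁻¹' {s} := by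
    ext ω
    simp
  rw [h, measureReal_biUnion_finset]
  · rw [Finset.sum_filter]
    rfl
  · intro s _ t _ hst
    exact Disjoint.preimage _ (Set.disjoint_singleton.2 hst)
  · exact fun s _ => hΦ s

theorem mass_law (hΦ : ∀ s, MeasurableSet (Φ ⁻¹' {s})) (f : S → β) (b : β) :
    mass (fun s => P.real (Φ ⁻¹' {s})) f b = P.real {ω | f (Φ ω) = b} :=
  sum_indicator_law hΦ (f ⁻¹' {b})

/-- If the mutual information of `A` and `B` is small, then a function of `B` is nearly independent
of `A`. -/
theorem dependence_law_le (hΦ : ∀ s, MeasurableSet (Φ ⁻¹' {s})) [Fintype α] [MeasurableSpace α]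
    [MeasurableSingletonClass α] [MeasurableSpace β] [Fintype γ] [MeasurableSpace γ]
    [MeasurableSingletonClass γ] {A : Ω → α} {B : Ω → β} {G : β → γ} (hA : Measurable A)
    (hB : Measurable B) (hG : Measurable G) {f : S → α} {g : S → γ} (hf : ∀ ω, f (Φ ω) = A ω)
    (hg : ∀ ω, g (Φ ω) = G (B ω)) {t : ℝ} (ht : 0 < t)
    (h : mutualInfo P A B ≤ ENNReal.ofReal (t ^ 2)) :
    dependence (fun s => P.real (Φ ⁻¹' {s})) f g ≤ 3 * t := by
  have hAB : Measurable fun ω => (A ω, B ω) := hA.prodMk hB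
  have i₁ : IsProbabilityMeasure (P.map fun ω => (A ω, B ω)) :=
    Measure.isProbabilityMeasure_map hAB.aemeasurable
  have i₂ : IsProbabilityMeasure (P.map A) := Measure.isProbabilityMeasure_map hA.aemeasurable
  have i₃ : IsProbabilityMeasure (P.map B) := Measure.isProbabilityMeasure_map hB.aemeasurable
  have hm : ∀ c, MeasurableSet (G ⁻¹' {c}) := fun c => hG (measurableSet_singleton c)
  -- The rectangles given by a value of `A` and a fibre of `G` are disjoint, so data processing for
  -- `G` is built into the estimate.
  have key := sum_abs_measure_sub_le_of_klDiv_le ht h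
    (E := fun p : α × γ => {p.1} ×ˢ (G ⁻¹' {p.2}))
    (fun p => (measurableSet_singleton p.1).prod (hm p.2)) (by
      intro p p' hp
      rw [Set.disjoint_left]
      rintro ⟨a, b⟩ h₁ h₂
      simp only [Set.mem_prod, Set.mem_singleton_iff, Set.mem_preimage] at h₁ h₂
      exact hp (Prod.ext (h₁.1.symm.trans h₂.1) (h₁.2.symm.trans h₂.2)))
  refine le_trans (le_of_eq ?_) key
  rw [dependence, Fintype.sum_prod_type]
  refine Finset.sum_congr rfl fun a _ => Finset.sum_congr rfl fun c _ => ?_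
  rw [mass_law hΦ, mass_law hΦ, mass_law hΦ, measureReal_prod_prod,
    map_measureReal_apply hAB ((measurableSet_singleton a).prod (hm c)),
    map_measureReal_apply hA (measurableSet_singleton a), map_measureReal_apply hB (hm c)]
  simp only [hf, hg]
  congr 3
  congr 1
  ext ω
  simp

end FiniteEntropy

/-! ### Reduction to finite private randomness -/

theorem exchange_congr {α : Type*} {a b a' b' : List α → α} {L : ℕ}
    (ha : ∀ h : List α, h.length ≤ L → a h = a' h) (hb : ∀ h : List α, h.length ≤ L → b h = b' h)
    (r : ℕ) (h : List α) (hr : h.length + 2 * r ≤ L) : exchange a b r h = exchange a' b' r h := by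
  induction r with
  | zero => rfl
  | succ r ih =>
    have h₁ := ih (by omega)
    have h₂ := OTProtocol.length_exchange a' b' r h
    have h₃ : a (exchange a' b' r h) = a' (exchange a' b' r h) := ha _ (by omega)
    simp only [exchange, h₁, h₃]
    rw [hb _ (by simp only [List.length_append, List.length_singleton]; omega)]

/-- A finite family of finite-valued measurable functions factors through a measurable function
with values in some `Fin N`. -/
theorem exists_fin_factor {Ω J : Type*} [MeasurableSpace Ω] [Finite J] {δ : J → Type*}
    [∀ j, Finite (δ j)] [∀ j, MeasurableSpace (δ j)] [∀ j, MeasurableSingletonClass (δ j)]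
    (f : ∀ j, Ω → δ j) (hf : ∀ j, Measurable (f j)) :
    ∃ (N : ℕ) (τ : Ω → Fin N), Measurable τ ∧ ∀ r r', τ r = τ r' → ∀ j, f j r = f j r' := by
  have hm : Measurable fun r j => f j r := measurable_pi_lambda _ hf
  refine ⟨Nat.card (∀ j, δ j), fun r => Finite.equivFin _ fun j => f j r,
    (measurable_of_countable _).comp hm, fun r r' h j => ?_⟩
  exact congrFun ((Finite.equivFin _).injective h) j

namespace OTProtocol

variable {𝒳 : Type*} {𝒴 : Fin 2 → Type*} [MeasurableSpace 𝒳] {n : ℕ} {k : Fin 2 → ℕ}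

/-- The protocol in which the private randomness is replaced by representatives. -/
abbrev coarsen (π : OTProtocol 𝒳 𝒴 n k) {TA : Type} {TB : Fin 2 → Type} [MeasurableSpace TA]
    [DiscreteMeasurableSpace TA] [∀ i, MeasurableSpace (TB i)]
    [∀ i, DiscreteMeasurableSpace (TB i)] (repA : TA → π.RandA) (repB : ∀ i, TB i → π.RandB i) :
    OTProtocol 𝒳 𝒴 n k where
  msgCard := π.msgCard
  RandA := TA
  RandB := TB
  rounds := π.rounds
  aliceMsg i m r h := π.aliceMsg i m (repA r) h
  bobMsg i z r y h := π.bobMsg i z (repB i r) y h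
  input l m r h := π.input l m (repA r) h
  decode i z r y h := π.decode i z (repB i r) y h
  measurable_aliceMsg _ _ _ := Measurable.of_discrete
  measurable_bobMsg _ _ _ _ := Measurable.of_discrete
  measurable_input _ _ _ := Measurable.of_discrete
  measurable_decode _ _ _ _ := Measurable.of_discrete

/-- The randomness `rA`, `rA'` of Alice leads to the same behaviour on short transcripts. -/
def AliceEquiv (π : OTProtocol 𝒳 𝒴 n k) (rA rA' : π.RandA) : Prop :=
  (∀ i m h, h.length ≤ π.maxLength → π.aliceMsg i m rA h = π.aliceMsg i m rA' h) ∧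
  ∀ l m h, (∀ i, (h i).length ≤ π.maxLength) → π.input l m rA h = π.input l m rA' h

/-- The randomness `rB`, `rB'` of Bob-`i` leads to the same behaviour on short transcripts. -/
def BobEquiv (π : OTProtocol 𝒳 𝒴 n k) (i : Fin 2) (rB rB' : π.RandB i) : Prop :=
  (∀ z y h, y.length ≤ n → h.length ≤ π.maxLength → π.bobMsg i z rB y h = π.bobMsg i z rB' y h) ∧
  ∀ z y h, h.length ≤ π.maxLength → π.decode i z rB y h = π.decode i z rB' y h

instance instDiscreteListFin (a : ℕ) : DiscreteMeasurableSpace (List (Fin a)) := ⟨fun _ => trivial⟩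

/-- On transcripts of bounded length Alice's strategy has finitely many arguments and finitely many
values. Her randomness thus matters only through a finite table, which depends measurably on it. -/
theorem exists_alice_table [Finite 𝒳] [DiscreteMeasurableSpace 𝒳] (π : OTProtocol 𝒳 𝒴 n k) :
    ∃ (N N' : ℕ) (τ : π.RandA → Fin N × Fin N'), Measurable τ ∧
      ∀ r r', τ r = τ r' → π.AliceEquiv r r' := by
  obtain ⟨N, τ, hτ, h⟩ := exists_fin_factor
    (J := Fin 2 × OTStrings k × ShortList π.msgCard π.maxLength)
    (fun j r => π.aliceMsg j.1 j.2.1 r j.2.2.1) fun j => π.measurable_aliceMsg _ _ _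
  obtain ⟨N', τ', hτ', h'⟩ := exists_fin_factor
    (J := Fin n × OTStrings k × (Fin 2 → ShortList π.msgCard π.maxLength))
    (fun j r => π.input j.1 j.2.1 r fun i => (j.2.2 i).1) fun j => π.measurable_input _ _ _
  refine ⟨N, N', fun r => (τ r, τ' r), hτ.prodMk hτ', fun r r' e => ⟨fun i m l hl => ?_,
    fun t m l hl => ?_⟩⟩
  · exact h r r' (congrArg Prod.fst e) (i, m, ⟨l, hl⟩)
  · exact h' r r' (congrArg Prod.snd e) (t, m, fun i => ⟨l i, hl i⟩)

theorem exists_bob_table [∀ i, Finite (𝒴 i)] (π : OTProtocol 𝒳 𝒴 n k) (i : Fin 2) :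
    ∃ (N N' : ℕ) (τ : π.RandB i → Fin N × Fin N'), Measurable τ ∧
      ∀ r r', τ r = τ r' → π.BobEquiv i r r' := by
  have : Finite {y : List (𝒴 i) // y.length ≤ n} := List.finite_length_le (𝒴 i) n
  obtain ⟨N, τ, hτ, h⟩ := exists_fin_factor
    (J := Bool × {y : List (𝒴 i) // y.length ≤ n} × ShortList π.msgCard π.maxLength)
    (fun j r => π.bobMsg i j.1 r j.2.1.1 j.2.2.1) fun j => π.measurable_bobMsg _ _ _ _
  obtain ⟨N', τ', hτ', h'⟩ := exists_fin_factor
    (J := Bool × (Fin n → 𝒴 i) × ShortList π.msgCard π.maxLength)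
    (fun j r => π.decode i j.1 r j.2.1 j.2.2.1) fun j => π.measurable_decode _ _ _ _
  refine ⟨N, N', fun r => (τ r, τ' r), hτ.prodMk hτ', fun r r' e => ⟨fun z y l hy hl => ?_,
    fun z y l hl => ?_⟩⟩
  · exact h r r' (congrArg Prod.fst e) (z, ⟨y, hy⟩, ⟨l, hl⟩)
  · exact h' r r' (congrArg Prod.snd e) (z, y, ⟨l, hl⟩)

section Coarsen

variable (π : OTProtocol 𝒳 𝒴 n k) {TA : Type} {TB : Fin 2 → Type} [MeasurableSpace TA]
    [DiscreteMeasurableSpace TA] [∀ i, MeasurableSpace (TB i)]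
    [∀ i, DiscreteMeasurableSpace (TB i)] {repA : TA → π.RandA} {repB : ∀ i, TB i → π.RandB i}

theorem transcript_coarsen (i : Fin 2) (m : OTStrings k) (z : Bool) {rA : π.RandA} {a : TA}
    (hA : π.AliceEquiv (repA a) rA) {rB : π.RandB i} {b : TB i} (hB : π.BobEquiv i (repB i b) rB)
    (y : Fin n → 𝒴 i) {l : ℕ} (hl : l ≤ n) :
    (π.coarsen repA repB).transcript i m z a b y l = π.transcript i m z rA rB y l := by
  induction l with
  | zero =>
    refine exchange_congr (L := π.maxLength) (hA.1 i m)
      (fun h hh => hB.1 z [] h (by simp) hh) _ _ ?_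
    have := π.length_transcript_le i m z rA rB y hl
    rwa [transcript, length_exchange] at this
  | succ l ih =>
    have h₁ := π.length_transcript_le i m z rA rB y hl
    rw [transcript, length_exchange] at h₁
    rw [transcript, transcript, ih (by omega)]
    exact exchange_congr (L := π.maxLength) (hA.1 i m)
      (fun h hh => hB.1 z _ h (by simp) hh) _ _ h₁

theorem channelInput_coarsen (m : OTStrings k) (z : Fin 2 → Bool) {rA : π.RandA} {a : TA}
    (hA : π.AliceEquiv (repA a) rA) {rB : ∀ i, π.RandB i} {b : ∀ i, TB i}
    (hB : ∀ i, π.BobEquiv i (repB i (b i)) (rB i)) (y : Fin n → ∀ i, 𝒴 i) :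
    (π.coarsen repA repB).channelInput m z a b y = π.channelInput m z rA rB y := by
  funext l
  have : (fun i => (π.coarsen repA repB).transcript i m (z i) a (b i) (fun t => y t i) l) =
      fun i => π.transcript i m (z i) rA (rB i) (fun t => y t i) l :=
    funext fun i => π.transcript_coarsen i m (z i) hA (hB i) _ l.2.le
  unfold channelInput
  rw [this]
  exact hA.2 l m _ fun i => π.length_transcript_le _ _ _ _ _ _ l.2.le

end Coarsen

/-! ### The law of a run with finite private randomness. -/

namespace Run

variable [∀ i, MeasurableSpace (𝒴 i)] {W : 𝒳 → PMF (∀ i, 𝒴 i)} {π : OTProtocol 𝒳 𝒴 n k}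

theorem measure_inputs (e : π.Run W) (E : Set (OTStrings k)) (F : Set (Fin 2 → Bool))
    {A : Set π.RandA} (hA : MeasurableSet A) {B : Set (∀ i, π.RandB i)} (hB : MeasurableSet B) :
    e.P.real {ω | e.M ω ∈ E ∧ e.Z ω ∈ F ∧ e.RA ω ∈ A ∧ e.RB ω ∈ B} =
      (uniformOn Set.univ).real E * ((uniformOn Set.univ).real F *
        ((e.P.map e.RA).real A * (Measure.pi fun i => e.P.map fun ω => e.RB ω i).real B)) := by
  have hm : Measurable fun ω => (e.M ω, e.Z ω, e.RA ω, e.RB ω) :=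
    e.measurable_M.prodMk (e.measurable_Z.prodMk (e.measurable_RA.prodMk e.measurable_RB))
  have hE : MeasurableSet E := E.toFinite.measurableSet
  have hF : MeasurableSet F := F.toFinite.measurableSet
  have i₁ : ∀ i, IsProbabilityMeasure (e.P.map fun ω => e.RB ω i) := fun i =>
    Measure.isProbabilityMeasure_map ((measurable_pi_apply i).comp e.measurable_RB).aemeasurable
  have i₂ : IsProbabilityMeasure (e.P.map e.RA) :=
    Measure.isProbabilityMeasure_map e.measurable_RA.aemeasurable
  rw [← measureReal_prod_prod, ← measureReal_prod_prod, ← measureReal_prod_prod, ← e.law_inputs,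
    map_measureReal_apply hm (hE.prod (hF.prod (hA.prod hB)))]
  rfl

variable {TA : Type} {TB : Fin 2 → Type} [MeasurableSpace TA]
    [DiscreteMeasurableSpace TA] [∀ i, MeasurableSpace (TB i)]
    [∀ i, DiscreteMeasurableSpace (TB i)] {repA : TA → π.RandA} {repB : ∀ i, TB i → π.RandB i}

/-- The outcome of a run, with coarsened private randomness. -/
def outcome (e : π.Run W) (repA : TA → π.RandA) (repB : ∀ i, TB i → π.RandB i)
    (τA : π.RandA → TA) (τB : ∀ i, π.RandB i → TB i) (ω : e.Ω) :
    (π.coarsen repA repB).Outcome :=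
  (e.M ω, e.Z ω, τA (e.RA ω), fun i => τB i (e.RB ω i), fun l => e.Y l ω)

variable (e : π.Run W) {τA : π.RandA → TA} {τB : ∀ i, π.RandB i → TB i}

theorem inputs_outcome (hA : ∀ r, π.AliceEquiv (repA (τA r)) r)
    (hB : ∀ i r, π.BobEquiv i (repB i (τB i r)) r) (ω : e.Ω) :
    (π.coarsen repA repB).inputs (e.outcome repA repB τA τB ω) = e.X ω :=
  π.channelInput_coarsen _ _ (hA _) (fun i => hB i _) _

theorem link_outcome (hA : ∀ r, π.AliceEquiv (repA (τA r)) r)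
    (hB : ∀ i r, π.BobEquiv i (repB i (τB i r)) r) (i : Fin 2) (ω : e.Ω) :
    (π.coarsen repA repB).link i n (e.outcome repA repB τA τB ω) = e.C i ω :=
  π.transcript_coarsen i _ _ (hA _) (hB i _) _ le_rfl

theorem estimate_outcome (hA : ∀ r, π.AliceEquiv (repA (τA r)) r)
    (hB : ∀ i r, π.BobEquiv i (repB i (τB i r)) r) (i : Fin 2) (ω : e.Ω) :
    (π.coarsen repA repB).estimateString i (e.outcome repA repB τA τB ω) = e.estimate i ω := by
  unfold estimateString
  rw [e.link_outcome hA hB]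
  exact (hB i _).2 _ _ _ (π.length_transcript_le _ _ _ _ _ _ le_rfl)

theorem measurable_outcome (hτA : Measurable τA) (hτB : ∀ i, Measurable (τB i)) :
    Measurable (e.outcome repA repB τA τB) :=
  e.measurable_M.prodMk (e.measurable_Z.prodMk ((hτA.comp e.measurable_RA).prodMk
      ((measurable_pi_lambda _ fun i =>
        (hτB i).comp ((measurable_pi_apply i).comp e.measurable_RB)).prodMk
        (measurable_pi_lambda _ e.measurable_Y))))

variable [∀ i, Fintype (𝒴 i)] [∀ i, DiscreteMeasurableSpace (𝒴 i)] [Fintype TA]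
  [∀ i, Fintype (TB i)]

theorem measurableSet_outcome (hτA : Measurable τA) (hτB : ∀ i, Measurable (τB i))
    (s : (π.coarsen repA repB).Outcome) :
    MeasurableSet (e.outcome repA repB τA τB ⁻¹' {s}) :=
  e.measurable_outcome hτA hτB (measurableSet_singleton s)

theorem isRunLaw_outcome (hτA : Measurable τA) (hτB : ∀ i, Measurable (τB i))
    (hA : ∀ r, π.AliceEquiv (repA (τA r)) r) (hB : ∀ i r, π.BobEquiv i (repB i (τB i r)) r) :
    (π.coarsen repA repB).IsRunLaw W
      (fun s => e.P.real (e.outcome repA repB τA τB ⁻¹' {s})) := by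
  have hΦ := e.measurableSet_outcome (repA := repA) (repB := repB) hτA hτB
  have i₁ : ∀ i, IsProbabilityMeasure (e.P.map fun ω => e.RB ω i) := fun i =>
    Measure.isProbabilityMeasure_map ((measurable_pi_apply i).comp e.measurable_RB).aemeasurable
  have i₂ : IsProbabilityMeasure (e.P.map e.RA) :=
    Measure.isProbabilityMeasure_map e.measurable_RA.aemeasurable
  refine ⟨fun _ => measureReal_nonneg, ?_, ?_, ?_, ?_, ?_⟩
  · have := sum_indicator_law (P := e.P) hΦ Set.univ
    rw [Set.indicator_univ] at this
    exact this.trans probReal_univ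
  · intro p
    rw [mass_law hΦ]
    have h := e.measure_inputs {p.1} {p.2} MeasurableSet.univ MeasurableSet.univ
    have hu : ∀ {α : Type} [Fintype α] [MeasurableSpace α] [MeasurableSingletonClass α] (a : α),
        (uniformOn (Set.univ : Set α)).real {a} = (Fintype.card α : ℝ)⁻¹ := by
      intro α _ _ _ a
      rw [measureReal_def, uniformOn_univ]
      simp
    rw [hu, hu] at h
    have he : {ω | ((e.outcome repA repB τA τB ω).1, (e.outcome repA repB τA τB ω).2.1) = p} =
        {ω | e.M ω ∈ ({p.1} : Set _) ∧ e.Z ω ∈ ({p.2} : Set _) ∧ e.RA ω ∈ Set.univ ∧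
          e.RB ω ∈ Set.univ} := by
      ext ω
      simp [outcome, Prod.ext_iff]
    rw [he, h, Fintype.card_prod]
    simp [mul_comm]
  · rintro ⟨m, a⟩ ⟨z, b⟩
    rw [mass_law hΦ, mass_law hΦ, mass_law hΦ]
    have hSA : MeasurableSet (τA ⁻¹' {a}) := hτA (measurableSet_singleton a)
    have hSB : MeasurableSet {r : ∀ i, π.RandB i | (fun i => τB i (r i)) = b} :=
      (measurable_pi_lambda _ fun i => (hτB i).comp (measurable_pi_apply i) :
        Measurable fun (r : ∀ i, π.RandB i) i => τB i (r i)) (measurableSet_singleton b)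
    have h₁ := e.measure_inputs {m} {z} hSA hSB
    have h₂ := e.measure_inputs {m} Set.univ hSA MeasurableSet.univ
    have h₃ := e.measure_inputs Set.univ {z} MeasurableSet.univ hSB
    simp only [probReal_univ, mul_one, one_mul] at h₂ h₃
    have e₁ : {ω | ((π.coarsen repA repB).alice (e.outcome repA repB τA τB ω),
        (e.outcome repA repB τA τB ω).2.1, (e.outcome repA repB τA τB ω).2.2.2.1) =
        ((m, a), z, b)} = {ω | e.M ω ∈ ({m} : Set _) ∧ e.Z ω ∈ ({z} : Set _) ∧
          e.RA ω ∈ τA ⁻¹' {a} ∧ e.RB ω ∈ {r : ∀ i, π.RandB i | (fun i => τB i (r i)) = b}} := by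
      ext ω
      simp only [outcome, alice, Prod.mk.injEq, Set.mem_ofPred_eq, Set.mem_singleton_iff,
        Set.mem_preimage]
      tauto
    have e₂ : {ω | (π.coarsen repA repB).alice (e.outcome repA repB τA τB ω) = (m, a)} =
        {ω | e.M ω ∈ ({m} : Set _) ∧ e.Z ω ∈ Set.univ ∧
          e.RA ω ∈ τA ⁻¹' {a} ∧ e.RB ω ∈ Set.univ} := by
      ext ω
      simp [outcome, alice]
    have e₃ : {ω | ((e.outcome repA repB τA τB ω).2.1, (e.outcome repA repB τA τB ω).2.2.2.1) =
        (z, b)} = {ω | e.M ω ∈ Set.univ ∧ e.Z ω ∈ ({z} : Set _) ∧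
          e.RA ω ∈ Set.univ ∧ e.RB ω ∈ {r : ∀ i, π.RandB i | (fun i => τB i (r i)) = b}} := by
      ext ω
      simp [outcome]
    rw [e₁, e₂, e₃, h₁, h₂, h₃]
    ring
  · intro l s
    rw [mass_law hΦ, mass_law hΦ]
    set E : Set (OTStrings k × (Fin 2 → Bool) × π.RandA × (∀ i, π.RandB i) ×
        (Set.Iio l → ∀ i, 𝒴 i)) :=
      (fun p => ((p.1, p.2.1, τA p.2.2.1, fun i => τB i (p.2.2.2.1 i), p.2.2.2.2) :
        OTStrings k × (Fin 2 → Bool) × TA × (∀ i, TB i) × (Set.Iio l → ∀ i, 𝒴 i))) ⁻¹'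
        {(π.coarsen repA repB).past l s} with hE
    have hEm : MeasurableSet E := by
      refine Measurable.prodMk measurable_fst (Measurable.prodMk (by fun_prop) (Measurable.prodMk
        (hτA.comp (by fun_prop)) (Measurable.prodMk (measurable_pi_lambda _ fun i =>
          (hτB i).comp (by fun_prop)) (by fun_prop)))) (measurableSet_singleton _)
    have h := e.law_channel l ((π.coarsen repA repB).inputs s l)
      ((π.coarsen repA repB).outputs s l) E hEm
    -- Already the coarsened past fixes the input, so on `E` the input condition in `law_channel`
    -- holds automatically and the channel law for the coarsened past follows.
    have hx : ∀ ω, (e.M ω, e.Z ω, e.RA ω, e.RB ω, fun t : Set.Iio l => e.Y t ω) ∈ E →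
        π.channelInput (e.M ω) (e.Z ω) (e.RA ω) (e.RB ω) (fun t => e.Y t ω) l =
          (π.coarsen repA repB).inputs s l := by
      intro ω hω
      exact (congrFun (e.inputs_outcome hA hB ω).symm l).trans
        ((π.coarsen repA repB).det_past_inputs l (e.outcome repA repB τA τB ω) s hω)
    have e₁ : {ω | ((π.coarsen repA repB).past l (e.outcome repA repB τA τB ω),
        (π.coarsen repA repB).outputs (e.outcome repA repB τA τB ω) l) =
        ((π.coarsen repA repB).past l s, (π.coarsen repA repB).outputs s l)} =
        {ω | (e.M ω, e.Z ω, e.RA ω, e.RB ω, fun t : Set.Iio l => e.Y t ω) ∈ E ∧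
          π.channelInput (e.M ω) (e.Z ω) (e.RA ω) (e.RB ω) (fun t => e.Y t ω) l =
            (π.coarsen repA repB).inputs s l ∧
          e.Y l ω = (π.coarsen repA repB).outputs s l} := by
      ext ω
      refine ⟨fun hω => ?_, fun hω => ?_⟩
      · have hω' := Prod.ext_iff.1 hω
        exact ⟨hω'.1, hx ω hω'.1, hω'.2⟩
      · exact Prod.ext hω.1 hω.2.2
    have e₂ : {ω | (π.coarsen repA repB).past l (e.outcome repA repB τA τB ω) =
        (π.coarsen repA repB).past l s} =
        {ω | (e.M ω, e.Z ω, e.RA ω, e.RB ω, fun t : Set.Iio l => e.Y t ω) ∈ E ∧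
          π.channelInput (e.M ω) (e.Z ω) (e.RA ω) (e.RB ω) (fun t => e.Y t ω) l =
            (π.coarsen repA repB).inputs s l} := by
      ext ω
      exact ⟨fun hω => ⟨hω, hx ω hω⟩, fun hω => hω.1⟩
    rw [e₁, e₂, measureReal_def, h, ENNReal.toReal_mul]
    rfl
  · intro l x y
    rw [mass_law hΦ, mass_law hΦ]
    have h := e.law_channel l x y Set.univ MeasurableSet.univ
    simp only [Set.mem_univ, true_and] at h
    have hx : ∀ ω, (π.coarsen repA repB).inputs (e.outcome repA repB τA τB ω) l =
        π.channelInput (e.M ω) (e.Z ω) (e.RA ω) (e.RB ω) (fun t => e.Y t ω) l :=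
      fun ω => congrFun (e.inputs_outcome hA hB ω) l
    simp only [Prod.mk.injEq, hx]
    rw [measureReal_def, measureReal_def, ← ENNReal.toReal_mul, ← h]
    rfl

end Run

end OTProtocol

/-! ### The converse -/

namespace OTProtocol

variable {𝒳 : Type*} {𝒴 : Fin 2 → Type*} [MeasurableSpace 𝒳] {n : ℕ} {k : Fin 2 → ℕ}

namespace Run

variable [∀ i, MeasurableSpace (𝒴 i)] {W : 𝒳 → PMF (∀ i, 𝒴 i)} {π : OTProtocol 𝒳 𝒴 n k}

/-- The run `e` is correct up to `t` and secure up to `t ^ 2`. -/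
structure IsSecure (e : π.Run W) (t : ℝ) : Prop where
  error_le : ∀ i, e.P {ω | e.estimate i ω ≠ e.chosen i ω} ≤ ENNReal.ofReal t
  unchosen_le : mutualInfo e.P (fun ω => (e.unchosen 0 ω, e.unchosen 1 ω))
    (fun ω => (e.V 0 ω, e.V 1 ω)) ≤ ENNReal.ofReal (t ^ 2)
  bit_le : ∀ i : Fin 2, mutualInfo e.P (fun ω => e.Z ω i)
    (fun ω => (e.U ω, e.V i.rev ω)) ≤ ENNReal.ofReal (t ^ 2)
  bits_le : mutualInfo e.P e.Z e.U ≤ ENNReal.ofReal (t ^ 2)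

variable {TA : Type} {TB : Fin 2 → Type} [MeasurableSpace TA]
    [DiscreteMeasurableSpace TA] [∀ i, MeasurableSpace (TB i)]
    [∀ i, DiscreteMeasurableSpace (TB i)] {repA : TA → π.RandA} {repB : ∀ i, TB i → π.RandB i}
    (e : π.Run W) {τA : π.RandA → TA} {τB : ∀ i, π.RandB i → TB i}
    [Fintype 𝒳] [DiscreteMeasurableSpace 𝒳]
    [∀ i, Fintype (𝒴 i)] [∀ i, DiscreteMeasurableSpace (𝒴 i)] [Fintype TA] [∀ i, Fintype (TB i)]

/-- The coarsened views are measurable functions of the true ones and so are no more informative. -/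
theorem isSecure_outcome (hτA : Measurable τA) (hτB : ∀ i, Measurable (τB i))
    (hA : ∀ r, π.AliceEquiv (repA (τA r)) r) (hB : ∀ i r, π.BobEquiv i (repB i (τB i r)) r)
    {t : ℝ} (ht : 0 < t) (hs : e.IsSecure t) :
    OTProtocol.IsSecure (π := π.coarsen repA repB)
      (fun s => e.P.real (e.outcome repA repB τA τB ⁻¹' {s})) (3 * t) := by
  have hΦm := e.measurable_outcome (repA := repA) (repB := repB) hτA hτB
  have hΦ := e.measurableSet_outcome (repA := repA) (repB := repB) hτA hτB
  -- Inputs and transcripts factor through the measurable finite outcome, which yields their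
  -- measurability at once.
  have hX : Measurable e.X := by
    rw [← funext (e.inputs_outcome hA hB)]
    exact (measurable_of_countable (π.coarsen repA repB).inputs).comp hΦm
  have hC : ∀ i, Measurable (e.C i) := by
    intro i
    rw [← funext (e.link_outcome hA hB i)]
    exact (measurable_of_countable ((π.coarsen repA repB).link i n)).comp hΦm
  have hU : Measurable e.U :=
    e.measurable_M.prodMk (e.measurable_RA.prodMk (hX.prodMk (measurable_pi_lambda _ hC)))
  have hZ : ∀ i, Measurable fun ω => e.Z ω i := fun i =>
    (measurable_pi_apply i).comp e.measurable_Z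
  have hV : ∀ i, Measurable (e.V i) := fun i =>
    (hZ i).prodMk (((measurable_pi_apply i).comp e.measurable_RB).prodMk
      ((measurable_pi_lambda _ fun l => (measurable_pi_apply i).comp (e.measurable_Y l)).prodMk
        (hC i)))
  have htr : Measurable (truncate (a := π.msgCard) π.maxLength) := Measurable.of_discrete
  set gU : OTStrings k × π.RandA × (Fin n → 𝒳) × (Fin 2 → List (Fin π.msgCard)) →
      OTStrings k × (Fin n → 𝒳) × (Fin 2 → ShortList π.msgCard π.maxLength) :=
    fun u => (u.1, u.2.2.1, fun i => truncate π.maxLength (u.2.2.2 i)) with hgU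
  set gV : ∀ i, Bool × π.RandB i × (Fin n → 𝒴 i) × List (Fin π.msgCard) →
      Bool × TB i × (Fin n → 𝒴 i) × ShortList π.msgCard π.maxLength :=
    fun i v => (v.1, τB i v.2.1, v.2.2.1, truncate π.maxLength v.2.2.2) with hgV
  have hgUm : Measurable gU :=
    measurable_fst.prodMk ((by fun_prop : Measurable fun u : OTStrings k × π.RandA ×
      (Fin n → 𝒳) × (Fin 2 → List (Fin π.msgCard)) => u.2.2.1).prodMk
      (measurable_pi_lambda _ fun i => htr.comp (by fun_prop)))
  have hgVm : ∀ i, Measurable (gV i) := fun i =>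
    measurable_fst.prodMk (((hτB i).comp (by fun_prop)).prodMk
      ((by fun_prop : Measurable fun v : Bool × π.RandB i × (Fin n → 𝒴 i) ×
        List (Fin π.msgCard) => v.2.2.1).prodMk (htr.comp (by fun_prop))))
  have hUΦ : ∀ ω, (π.coarsen repA repB).aliceView (e.outcome repA repB τA τB ω) = gU (e.U ω) := by
    intro ω
    have h : ∀ i, (π.coarsen repA repB).link i n (e.outcome repA repB τA τB ω) = e.C i ω :=
      fun i => e.link_outcome hA hB i ω
    unfold aliceView
    rw [e.inputs_outcome hA hB]
    simp only [h]
    rfl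
  have hVΦ : ∀ i ω, (π.coarsen repA repB).bobView i (e.outcome repA repB τA τB ω) =
      gV i (e.V i ω) := by
    intro i ω
    unfold bobView
    rw [e.link_outcome hA hB]
    rfl
  have hM : ∀ (i : Fin 2), Measurable (e.unchosen i) := by
    intro i
    exact (measurable_of_countable fun p : OTStrings k × (Fin 2 → Bool) => p.1 i (!p.2 i)).comp
      (e.measurable_M.prodMk e.measurable_Z)
  refine ⟨fun i => ?_, ?_, fun i => ?_, ?_⟩
  · rw [sum_indicator_law hΦ]
    have h := ENNReal.toReal_le_of_le_ofReal ht.le (hs.error_le i)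
    have h' : {ω | e.outcome repA repB τA τB ω ∈
        {s | (π.coarsen repA repB).estimateString i s ≠
          (π.coarsen repA repB).chosenString i s}} =
        {ω | e.estimate i ω ≠ e.chosen i ω} := by
      ext ω
      change (π.coarsen repA repB).estimateString i (e.outcome repA repB τA τB ω) ≠ _ ↔ _
      rw [e.estimate_outcome hA hB]
      rfl
    rw [h', measureReal_def]
    linarith
  · exact dependence_law_le hΦ ((hM 0).prodMk (hM 1)) ((hV 0).prodMk (hV 1))
      (G := fun v => (gV 0 v.1, gV 1 v.2)) (((hgVm 0).comp measurable_fst).prodMk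
        ((hgVm 1).comp measurable_snd)) (fun ω => rfl)
      (fun ω => Prod.ext (hVΦ 0 ω) (hVΦ 1 ω)) ht hs.unchosen_le
  · exact dependence_law_le hΦ (hZ i) (hU.prodMk (hV i.rev))
      (G := fun v => (gU v.1, gV i.rev v.2)) ((hgUm.comp measurable_fst).prodMk
        ((hgVm i.rev).comp measurable_snd)) (fun ω => rfl)
      (fun ω => Prod.ext (hUΦ ω) (hVΦ i.rev ω)) ht (hs.bit_le i)
  · exact dependence_law_le hΦ e.measurable_Z hU hgUm (fun ω => rfl) hUΦ ht hs.bits_le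

theorem exists_finite_law :
    ∃ (π' : OTProtocol 𝒳 𝒴 n k) (_ : Fintype π'.RandA) (_ : ∀ i, Fintype (π'.RandB i))
      (q : π'.Outcome → ℝ), π'.IsRunLaw W q ∧
        ∀ t, 0 < t → e.IsSecure t → OTProtocol.IsSecure q (3 * t) := by
  obtain ⟨N, N', τA, hτA, hA⟩ := π.exists_alice_table
  choose K K' τB hτB hB using π.exists_bob_table
  obtain ⟨ω⟩ := e.P.nonempty_of_neZero
  have : Nonempty π.RandA := ⟨e.RA ω⟩
  have : ∀ i, Nonempty (π.RandB i) := fun i => ⟨e.RB ω i⟩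
  -- The representative of a table entry is any randomness that produces it; it behaves as the
  -- original does on all transcripts that can occur.
  have hA' : ∀ r, π.AliceEquiv (Function.invFun τA (τA r)) r :=
    fun r => hA _ _ (Function.invFun_eq ⟨r, rfl⟩)
  have hB' : ∀ i r, π.BobEquiv i (Function.invFun (τB i) (τB i r)) r :=
    fun i r => hB i _ _ (Function.invFun_eq ⟨r, rfl⟩)
  exact ⟨π.coarsen (Function.invFun τA) fun i => Function.invFun (τB i),
    inferInstanceAs (Fintype (Fin N × Fin N')), fun i => inferInstanceAs (Fintype (Fin _ × Fin _)),
    _, e.isRunLaw_outcome hτA hτB hA' hB', fun t ht hs => e.isSecure_outcome hτA hτB hA' hB' ht hs⟩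

end Run

end OTProtocol

/-- Divide by n and let n tend to infinity with `t` fixed, then let `t` tend to 0. Convergence of
v/n keeps the error term of order `t`. The factor `3 * t` is the total variation obtained from a
divergence of at most t². -/
theorem le_of_eventually_le_mul_add {u v : ℕ → ℝ} {a b c : ℝ}
    (hu : Tendsto (fun n => u n / n) atTop (𝓝 a)) (hv : Tendsto (fun n => v n / n) atTop (𝓝 b))
    (h : ∀ t : ℝ, 0 < t → ∀ᶠ n : ℕ in atTop, u n ≤ n * c + 4 * (3 * t) * v n + 5) : a ≤ c := by
  have key : ∀ t : ℝ, 0 < t → a ≤ c + 4 * (3 * t) * b := by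
    intro t ht
    have h₁ : Tendsto (fun n : ℕ => c + 4 * (3 * t) * (v n / n) + 5 / n) atTop
        (𝓝 (c + 4 * (3 * t) * b + 0)) :=
      (tendsto_const_nhds.add (hv.const_mul _)).add (tendsto_const_div_atTop_nhds_zero_nat 5)
    rw [add_zero] at h₁
    refine le_of_tendsto_of_tendsto hu h₁ ?_
    filter_upwards [h t ht, eventually_gt_atTop 0] with n hn hn₀
    have : (0 : ℝ) < n := by exact_mod_cast hn₀
    rw [div_le_iff₀ this]
    refine hn.trans_eq ?_
    field_simp
  have h₂ : Tendsto (fun t : ℝ => c + 4 * (3 * t) * b) (𝓝[>] 0) (𝓝 (c + 4 * (3 * 0) * b)) := by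
    refine Tendsto.mono_left (Continuous.tendsto ?_ 0) nhdsWithin_le_nhds
    fun_prop
  rw [mul_zero, mul_zero, zero_mul, add_zero] at h₂
  exact ge_of_tendsto h₂ (eventually_nhdsWithin_of_forall fun t ht => key t ht)

theorem mainTheorem2 {𝒳 : Type*} {𝒴 : Fin 2 → Type*}
    [Fintype 𝒳] [MeasurableSpace 𝒳] [DiscreteMeasurableSpace 𝒳]
    [∀ i, Fintype (𝒴 i)] [∀ i, MeasurableSpace (𝒴 i)] [∀ i, DiscreteMeasurableSpace (𝒴 i)]
    (W : 𝒳 → PMF (∀ i, 𝒴 i)) (R : Fin 2 → ℝ) (hR : AchievableColluding W R) :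
    (∀ i, 0 ≤ R i) ∧
    (∀ i, R i ≤ min (maxI W i) (min (maxCondI W i) (maxEquivocation W))) ∧
    R 0 + R 1 ≤ min (maxJointI W) (maxEquivocation W) := by
  obtain ⟨k, π, e, hk, herr, hun, hbit, hbits, -⟩ := hR
  have hsec : ∀ t : ℝ, 0 < t → ∀ᶠ n in atTop, (e n).IsSecure t := by
    intro t ht
    have h₁ : (0 : ℝ≥0∞) < ENNReal.ofReal t := ENNReal.ofReal_pos.2 ht
    have h₂ : (0 : ℝ≥0∞) < ENNReal.ofReal (t ^ 2) := ENNReal.ofReal_pos.2 (by positivity)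
    filter_upwards [eventually_all.2 fun i => (herr i).eventually_le_const h₁,
      hun.eventually_le_const h₂, eventually_all.2 fun i => (hbit i).eventually_le_const h₂,
      hbits.eventually_le_const h₂] with n a₁ a₂ a₃ a₄
    exact ⟨a₁, a₂, a₃, a₄⟩
  have hsum : Tendsto (fun n => ((k n 0 : ℝ) + k n 1) / n) atTop (𝓝 (R 0 + R 1)) := by
    simp only [add_div]
    exact (hk 0).add (hk 1)
  have hnonneg : ∀ i, 0 ≤ R i := fun i => ge_of_tendsto' (hk i) fun n => by positivity
  have hI : ∀ i, R i ≤ maxI W i := fun i =>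
    le_of_eventually_le_mul_add (hk i) hsum fun t ht => (hsec t ht).mono fun n hn => by
      obtain ⟨π', _, _, q, hq, hs⟩ := (e n).exists_finite_law
      exact hq.length_le_maxI (by positivity) (hs t ht hn) i
  have hCI : ∀ i, R i ≤ maxCondI W i := fun i =>
    le_of_eventually_le_mul_add (hk i) hsum fun t ht => (hsec t ht).mono fun n hn => by
      obtain ⟨π', _, _, q, hq, hs⟩ := (e n).exists_finite_law
      exact hq.length_le_maxCondI (by positivity) (hs t ht hn) i
  have hJ : R 0 + R 1 ≤ maxJointI W :=
    le_of_eventually_le_mul_add hsum hsum fun t ht => (hsec t ht).mono fun n hn => by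
      obtain ⟨π', _, _, q, hq, hs⟩ := (e n).exists_finite_law
      exact hq.sum_lengths_le_maxJointI (hs t ht hn)
  have hE : R 0 + R 1 ≤ maxEquivocation W :=
    le_of_eventually_le_mul_add hsum hsum fun t ht => (hsec t ht).mono fun n hn => by
      obtain ⟨π', _, _, q, hq, hs⟩ := (e n).exists_finite_law
      exact hq.sum_lengths_le_maxEquivocation (hs t ht hn)
  -- Each rate is at most the sum, since the other rate is nonnegative.
  have hRE : ∀ i, R i ≤ maxEquivocation W := fun i =>
    OTProtocol.forall_fin_two_rev (P := fun i => R i ≤ maxEquivocation W) 0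
      (by linarith [hnonneg 1]) (by change R 1 ≤ _; linarith [hnonneg 0]) i
  exact ⟨hnonneg, fun i => le_min (hI i) (le_min (hCI i) (hRE i)), le_min hJ hE⟩
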